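/- Let $E$ be a finite-dimensional real Euclidean space and let $W\subset O(E)$ be a finite group generated by reflections. Let $S\subset W$ be the set of all reflections in $W$, and let $\mathfrak h=\mathbb C\otimes_{\mathbb R}E$. For each $s\in S$ choose a nonzero real linear function $\alpha_s\in\mathfrak h^*$ vanishing on the reflection hyperplane of $s$, with coroot $\alpha_s^\vee=2(\alpha_s,-)/(\alpha_s,\alpha_s)\in\mathfrak h$, and let $c:S\to\mathbb C$ be a function invariant under conjugation by $W$. The rational Cherednik algebra $\mathsf H_c$ is the unital associative $\mathbb C$-algebra generated by the vector spaces $\mathfrak h$, $\mathfrak h^*$ and the group $W$ with defining relations, for $x,x_1,x_2\in\mathfrak h^*$, $y,y_1,y_2\in\mathfrak h$, $w\in W$, $$w x w^{-1}=w(x),\quad w y w^{-1}=w(y),\quad x_1x_2=x_2x_1,\quad y_1y_2=y_2y_1,$$ $$yx-xy=\langle y,x\rangle+\sum_{s\in S}c_s\,\langle y,\alpha_s\rangle\langle\alpha_s^\vee,x\rangle\, s .$$ Let $A^+\subset\mathsf H_c$ (resp. $A^-\subset\mathsf H_c$) be the non-unital subalgebra of $W$-invariant polynomials without constant term in the elements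 of $\mathfrak h^*$ (resp. of $\mathfrak h$). Let ${}^\uparrow\mathscr O$ (resp. $\mathscr O_\downarrow$) be the category of finitely generated left (resp. right) $\mathsf H_c$-modules $M$ on which $A^-$ (resp. $A^+$) acts locally nilpotently, i.e. for each $m\in M$ there is an $n$ such that every product of $n$ elements of $A^-$ (resp. $A^+$) kills $m$. For an irreducible complex representation $\sigma$ of $W$ let $L_\sigma$ be the quotient of the standard module $\mathsf H_c\otimes_{\mathbb C[\mathfrak h^*]\# W}\sigma$ (with $\mathfrak h$ acting on $\sigma$ by $0$) by the sum of all its proper submodules. Then: 1. For every two-sided ideal $I\subsetneq\mathsf H_c$ the following are equivalent: (i) $I$ is primitive (the annihilator of a simple left module); (ii) $I$ is prime (for two-sided ideals $J_1,J_2$, $J_1J_2\subset I$ implies $J_1\subset I$ or $J_2\subset I$); (iii) $I$ is the annihilator of a simple object of ${}^\uparrow\mathscr O$; (iv) $I$ is the (right) annihilator of a simple object of $\mathscr O_\downarrow$. 2. Every primitive ideal of $\mathsf H_c$ is the annihilator of a simple highest weight module: it equals $\mathrm{Ann}(L_\sigma)$ for some irreducible representation $\sigma$ of $W$ such that $L_\sigma$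 is simple. 3. The set $\mathrm{Prim}(\mathsf H_c)$ of primitive ideals is finite. 4. $\mathsf H_c$ has finite length as an $\mathsf H_c\otimes_{\mathbb C}\mathsf H_c^{\mathrm{op}}$-module, i.e. as a bimodule over itself. -/

import Mathlib

open scoped TensorProduct

universe u

noncomputable section

/-! ### Ring-theoretic notions -/

section Rings

variable {A : Type u} [Ring A]

/-- A primitive ideal: the annihilator of a simple left module. -/
def IsPrimitiveIdeal (I : Ideal A) : Prop :=
  ∃ (L : Type u) (_ : AddCommGroup L) (_ : Module A L),
    IsSimpleModule A L ∧ I = Module.annihilator A L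

/-- A prime ideal of a noncommutative ring, tested on products of two-sided ideals
(`Ideal.IsPrime` would mean completely prime). -/
def IsPrimeTwoSidedIdeal (I : Ideal A) : Prop :=
  I.IsTwoSided ∧ I ≠ ⊤ ∧
    ∀ J₁ J₂ : Ideal A, J₁.IsTwoSided → J₂.IsTwoSided → J₁ * J₂ ≤ I → J₁ ≤ I ∨ J₂ ≤ I

/-- The set `T` acts locally nilpotently on the left module `M`: every `m` is killed by all
products of `n = n(m)` elements of `T`. -/
def LeftLocallyNilpotent (T : Set A) (M : Type u) [AddCommGroup M] [Module A M] : Prop :=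
  ∀ m : M, ∃ n : ℕ, ∀ l : List A, l.length = n → (∀ a ∈ l, a ∈ T) → l.prod • m = 0

/-- The set `T` acts locally nilpotently on the right module `M`. Right `A`-modules are
modules over `Aᵐᵒᵖ`. -/
def RightLocallyNilpotent (T : Set A) (M : Type u) [AddCommGroup M] [Module Aᵐᵒᵖ M] : Prop :=
  ∀ m : M, ∃ n : ℕ, ∀ l : List A, l.length = n → (∀ a ∈ l, a ∈ T) →
    MulOpposite.op l.prod • m = 0

/-- `A` has finite length as a module over `A ⊗ Aᵐᵒᵖ`, i.e. as an `A`-bimodule, the action being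
`(a ⊗ b) • x = a * x * b`. -/
def HasFiniteLengthAsBimodule (A : Type u) [Ring A] [Algebra ℂ A] : Prop :=
  letI : Module (A ⊗[ℂ] Aᵐᵒᵖ) A := TensorProduct.Algebra.module
  IsFiniteLength (A ⊗[ℂ] Aᵐᵒᵖ) A

end Rings

/-! ### Finite reflection groups and rational Cherednik algebras -/

namespace Cherednik

variable {E : Type u} [NormedAddCommGroup E] [InnerProductSpace ℝ E] [FiniteDimensional ℝ E]

/-- `W` is a finite Coxeter group: it is finite and generated by the orthogonal reflections
in hyperplanes of the Euclidean space `E` that it contains. -/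
def IsFiniteCoxeterGroup (W : Subgroup (E ≃ₗᵢ[ℝ] E)) : Prop :=
  Finite W ∧
    W = Subgroup.closure {s | s ∈ W ∧ ∃ a : E, a ≠ 0 ∧ s = (Submodule.span ℝ {a})ᗮ.reflection}

/-- The set `S` of all reflections contained in `W`. -/
abbrev Refl (W : Subgroup (E ≃ₗᵢ[ℝ] E)) : Type u :=
  {s : W // ∃ a : E, a ≠ 0 ∧ (s : E ≃ₗᵢ[ℝ] E) = (Submodule.span ℝ {a})ᗮ.reflection}

/-- A choice of roots: for every reflection `s ∈ S`, a nonzero vector of `E` orthogonal to the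
hyperplane `H_s` of `s`. -/
def IsRootChoice (W : Subgroup (E ≃ₗᵢ[ℝ] E)) (a : Refl W → E) : Prop :=
  ∀ s : Refl W, a s ≠ 0 ∧ (s.1 : E ≃ₗᵢ[ℝ] E) = (Submodule.span ℝ {a s})ᗮ.reflection

/-- The function `c` on `S` is invariant under conjugation by `W`. -/
def IsInvariant (W : Subgroup (E ≃ₗᵢ[ℝ] E)) (c : Refl W → ℂ) : Prop :=
  ∀ (w : W) (s s' : Refl W), s'.1 = w * s.1 * w⁻¹ → c s' = c s

variable (E) in
/-- The complexification `𝔥` of `E`. -/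
abbrev 𝔥 : Type u := ℂ ⊗[ℝ] E

variable (E) in
/-- The dual space `𝔥*`. -/
abbrev 𝔥Dual : Type u := Module.Dual ℂ (𝔥 E)

/-- The action of an isometry of `E` on `𝔥`. -/
def act (w : E ≃ₗᵢ[ℝ] E) : 𝔥 E →ₗ[ℂ] 𝔥 E :=
  LinearMap.baseChange ℂ (w.toLinearEquiv : E →ₗ[ℝ] E)

/-- The contragredient action of an isometry of `E` on `𝔥*`. -/
def actDual (w : E ≃ₗᵢ[ℝ] E) (x : 𝔥Dual E) : 𝔥Dual E :=
  x ∘ₗ act w⁻¹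

/-- The root `α ∈ 𝔥*` given by `a : E`: the complex-linear extension of `(a, -)`. -/
def root (a : E) : 𝔥Dual E :=
  Module.Dual.baseChange ℂ (innerₛₗ ℝ a : E →ₗ[ℝ] ℝ)

/-- The coroot `α^∨ = 2 a / (a, a) ∈ 𝔥`. -/
def coroot (a : E) : 𝔥 E :=
  (1 : ℂ) ⊗ₜ[ℝ] ((2 / inner ℝ a a) • a)

/-- Generators of the rational Cherednik algebra: the elements of `𝔥`, `𝔥*` and `W`. -/
inductive Gen (W : Subgroup (E ≃ₗᵢ[ℝ] E)) : Type u
  | y : 𝔥 E → Gen W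
  | x : 𝔥Dual E → Gen W
  | w : W → Gen W

variable {W : Subgroup (E ≃ₗᵢ[ℝ] E)}

/-- The generator of the free algebra given by `y ∈ 𝔥`. -/
abbrev gY (W : Subgroup (E ≃ₗᵢ[ℝ] E)) (y : 𝔥 E) : FreeAlgebra ℂ (Gen W) :=
  FreeAlgebra.ι ℂ (Gen.y y)

/-- The generator of the free algebra given by `x ∈ 𝔥*`. -/
abbrev gX (W : Subgroup (E ≃ₗᵢ[ℝ] E)) (x : 𝔥Dual E) : FreeAlgebra ℂ (Gen W) :=
  FreeAlgebra.ι ℂ (Gen.x x)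

/-- The generator of the free algebra given by `w ∈ W`. -/
abbrev gW (W : Subgroup (E ≃ₗᵢ[ℝ] E)) (w : W) : FreeAlgebra ℂ (Gen W) :=
  FreeAlgebra.ι ℂ (Gen.w w)

/-- The defining relations. The first six say that `𝔥` and `𝔥*` are mapped linearly and that
the product of `W` is kept; the other ones are the relations of the rational Cherednik algebra. -/
inductive Rel (W : Subgroup (E ≃ₗᵢ[ℝ] E)) (a : Refl W → E) (c : Refl W → ℂ) :
    FreeAlgebra ℂ (Gen W) → FreeAlgebra ℂ (Gen W) → Prop
  | y_add (y₁ y₂ : 𝔥 E) : Rel W a c (gY W (y₁ + y₂)) (gY W y₁ + gY W y₂)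
  | y_smul (z : ℂ) (y : 𝔥 E) : Rel W a c (gY W (z • y)) (z • gY W y)
  | x_add (x₁ x₂ : 𝔥Dual E) : Rel W a c (gX W (x₁ + x₂)) (gX W x₁ + gX W x₂)
  | x_smul (z : ℂ) (x : 𝔥Dual E) : Rel W a c (gX W (z • x)) (z • gX W x)
  | w_one : Rel W a c (gW W 1) 1
  | w_mul (w₁ w₂ : W) : Rel W a c (gW W (w₁ * w₂)) (gW W w₁ * gW W w₂)
  | w_x (w : W) (x : 𝔥Dual E) : Rel W a c (gW W w * gX W x * gW W w⁻¹) (gX W (actDual w.1 x))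
  | w_y (w : W) (y : 𝔥 E) : Rel W a c (gW W w * gY W y * gW W w⁻¹) (gY W (act w.1 y))
  | x_comm (x₁ x₂ : 𝔥Dual E) : Rel W a c (gX W x₁ * gX W x₂) (gX W x₂ * gX W x₁)
  | y_comm (y₁ y₂ : 𝔥 E) : Rel W a c (gY W y₁ * gY W y₂) (gY W y₂ * gY W y₁)
  | y_x (y : 𝔥 E) (x : 𝔥Dual E) : Rel W a c (gY W y * gX W x - gX W x * gY W y)
      (algebraMap ℂ _ (x y) +
        ∑ᶠ s : Refl W, (c s * root (a s) y * x (coroot (a s))) • gW W s.1)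

/-- The rational Cherednik algebra `H_c`. -/
def H (W : Subgroup (E ≃ₗᵢ[ℝ] E)) (a : Refl W → E) (c : Refl W → ℂ) : Type u :=
  RingQuot (Rel W a c)

variable {a : Refl W → E} {c : Refl W → ℂ}

instance : Ring (H W a c) := inferInstanceAs (Ring (RingQuot (Rel W a c)))

instance : Algebra ℂ (H W a c) := inferInstanceAs (Algebra ℂ (RingQuot (Rel W a c)))

/-- The class in `H_c` of an element of the free algebra. -/
def mk (W : Subgroup (E ≃ₗᵢ[ℝ] E)) (a : Refl W → E) (c : Refl W → ℂ) :
    FreeAlgebra ℂ (Gen W) →ₐ[ℂ] H W a c :=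
  RingQuot.mkAlgHom ℂ (Rel W a c)

variable (W a c) in
/-- The element of `H_c` given by `y ∈ 𝔥`. -/
def ofY (y : 𝔥 E) : H W a c := mk W a c (gY W y)

variable (W a c) in
/-- The element of `H_c` given by `x ∈ 𝔥*`. -/
def ofX (x : 𝔥Dual E) : H W a c := mk W a c (gX W x)

variable (W a c) in
/-- The element of `H_c` given by `w ∈ W`. -/
def ofW (w : W) : H W a c := mk W a c (gW W w)

variable (W a c) in
/-- `A⁺ = ℂ^{>0}[𝔥]^W`: the `W`-invariant elements of the non-unital subalgebra generated
by `𝔥*`. Invariance under `w` means commuting with `w`. -/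
def APlus : NonUnitalSubalgebra ℂ (H W a c) :=
  NonUnitalAlgebra.adjoin ℂ (Set.range (ofX W a c)) ⊓
    NonUnitalSubalgebra.centralizer ℂ (Set.range (ofW W a c))

variable (W a c) in
/-- `A⁻ = ℂ^{>0}[𝔥*]^W`: the `W`-invariant elements of the non-unital subalgebra generated
by `𝔥`. -/
def AMinus : NonUnitalSubalgebra ℂ (H W a c) :=
  NonUnitalAlgebra.adjoin ℂ (Set.range (ofY W a c)) ⊓
    NonUnitalSubalgebra.centralizer ℂ (Set.range (ofW W a c))

/-- `M` belongs to the category of finitely generated left modules with locally nilpotent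
action of `A⁻`. -/
def InOUp (W : Subgroup (E ≃ₗᵢ[ℝ] E)) (a : Refl W → E) (c : Refl W → ℂ)
    (M : Type u) [AddCommGroup M] [Module (H W a c) M] : Prop :=
  Module.Finite (H W a c) M ∧ LeftLocallyNilpotent (AMinus W a c : Set (H W a c)) M

/-- `M` belongs to the category of finitely generated right modules with locally nilpotent
action of `A⁺`. -/
def InODown (W : Subgroup (E ≃ₗᵢ[ℝ] E)) (a : Refl W → E) (c : Refl W → ℂ)
    (M : Type u) [AddCommGroup M] [Module (H W a c)ᵐᵒᵖ M] : Prop :=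
  Module.Finite (H W a c)ᵐᵒᵖ M ∧ RightLocallyNilpotent (APlus W a c : Set (H W a c)) M

/-! ### Standard modules and simple highest weight modules -/

variable {V : Type u} [AddCommGroup V] [Module ℂ V]

variable (a c) in
/-- The relations of the standard module: `h w ⊗ v = h ⊗ w v` for `w ∈ W`, and `h y ⊗ v = 0`
for `y ∈ 𝔥`. -/
def standardRel (σ : Representation ℂ W V) : Submodule (H W a c) (H W a c ⊗[ℂ] V) :=
  Submodule.span (H W a c)
    ({t | ∃ (w : W) (v : V), t = ofW W a c w ⊗ₜ[ℂ] v - (1 : H W a c) ⊗ₜ[ℂ] σ w v} ∪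
      {t | ∃ (y : 𝔥 E) (v : V), t = ofY W a c y ⊗ₜ[ℂ] v})

variable (a c) in
/-- The standard module `H_c ⊗_{ℂ[𝔥*] # W} σ`, where `𝔥` acts on `σ` by zero. -/
abbrev Standard (σ : Representation ℂ W V) : Type u :=
  (H W a c ⊗[ℂ] V) ⧸ standardRel a c σ

variable (a c) in
/-- The highest weight module `L_σ`: the quotient of the standard module by the sum of all its
proper submodules. -/
abbrev L (σ : Representation ℂ W V) : Type u :=
  Standard a c σ ⧸ sSup {N : Submodule (H W a c) (Standard a c σ) | N ≠ ⊤}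

end Cherednik

end

/-! The algebra `H_c` has a triangular decomposition, with commuting raising operators `𝔥*`, the
group algebra in the middle and commuting lowering operators `𝔥`, and it contains an Euler element
`eu` which grades it by `[eu, x] = x` and `[eu, y] = -y`. Let `M` be a module over such an algebra
`H` which is finite over the commutative subalgebra generated by `𝔥*`, and let `Fⱼ = 𝔥*ʲ M`. There
are nonzero polynomials `p` and `q` with `p(eu) M ⊆ F₁` and `q(eu) ∈ 𝔥* H`. If `N'` and `N` are
submodules of `M` with `N' ⊆ N + Fⱼ`, then `p(eu - j)` and `q(eu)` both map `N'` into `N + Fⱼ₊₁`;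
for large `j` the polynomials `p(X - j)` and `q` are coprime, so `N' ⊆ N + Fⱼ₊₁`. Krull's
intersection theorem and the grading show that `N` is the intersection of the `N + Fⱼ`. Hence a
submodule of `M` is determined by its image in a single finite-dimensional quotient `M / Fₙ`, and
`M` has finite length.

The class of these algebras is closed under opposites and tensor products. Applied to the bimodule
`H` over `H ⊗ Hᵒᵖ` with raising operators `𝔥* ⊗ 1 + 1 ⊗ 𝔥`, the argument shows that `H` has finite
length, which leaves room for only finitely many primes, and that a two-sided ideal `I` is the
intersection of the left ideals `I + H 𝔥ⁿ`. The annihilators of the modules `H / (I + H 𝔥ⁿ)` then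
form a descending chain of bimodules with intersection `I`, so one of them is `I`, and the module is
in category `𝒪`. If `I` is prime, one of the finitely many composition factors of this module
already has annihilator `I`. A simple module in category `𝒪` contains a nonzero vector killed by `𝔥`
and is therefore a quotient of a standard module. -/

open MulOpposite Polynomial

attribute [local instance] LieRing.ofAssociativeRing

section GradedPowers

variable {K A : Type*} [CommRing K] [Ring A] [Algebra K A]

theorem toSubmodule_adjoin_eq_iSup_pow (P : Submodule K A) :
    (Algebra.adjoin K (P : Set A)).toSubmodule = ⨆ n, P ^ n := by
  apply le_antisymm
  · have one_mem : (1 : A) ∈ ⨆ n, P ^ n :=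
      Submodule.mem_iSup_of_mem 0 (by rw [pow_zero]; exact Submodule.one_le.mp le_rfl)
    have mul_le : (⨆ n, P ^ n) * (⨆ n, P ^ n) ≤ ⨆ n, P ^ n := by
      simp only [Submodule.iSup_mul, Submodule.mul_iSup, ← pow_add]
      exact iSup_le fun m => iSup_le fun n => le_iSup (P ^ ·) (n + m)
    let S := (⨆ n, P ^ n).toSubalgebra one_mem fun _ _ hx hy => mul_le (Submodule.mul_mem_mul hx hy)
    have le_S : (P : Set A) ⊆ S := fun x hx =>
      Submodule.mem_iSup_of_mem (p := (P ^ ·)) 1 (by rwa [pow_one])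
    exact Algebra.adjoin_le (S := S) le_S
  · refine iSup_le fun n => ?_
    induction n with
    | zero => simp
    | succ n ih =>
      rw [pow_succ, ← (Algebra.adjoin K (P : Set A)).isIdempotentElem_toSubmodule.eq]
      exact mul_le_mul' ih Algebra.subset_adjoin

theorem exists_mem_ideal_smul_eq_self {R M : Type*} [CommRing R] [IsNoetherianRing R]
    [AddCommGroup M] [Module R M] [Module.Finite R M] (I : Ideal R) :
    ∃ r ∈ I, ∀ m ∈ ⨅ n : ℕ, I ^ n • (⊤ : Submodule R M), r • m = m := by
  refine Submodule.exists_mem_and_smul_eq_self_of_fg_of_le_smul I _ (IsNoetherian.noetherian _)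
    fun x hx => ?_
  obtain ⟨r, hr⟩ := (I.mem_iInf_smul_pow_eq_bot_iff x).mp hx
  exact hr ▸ Submodule.smul_mem_smul r.2 hx

variable {M : Type*} [AddCommGroup M] [Module K M] [Module A M] [IsScalarTower K A M]

open scoped IsMulCommutative in
theorem exists_mem_iSup_pow_smul_eq_self [IsNoetherianRing K] {P : Submodule K A} (fg : P.FG)
    (comm : ∀ a ∈ P, ∀ b ∈ P, a * b = b * a) [Module.Finite (Algebra.adjoin K (P : Set A)) M] :
    ∃ r ∈ ⨆ n, P ^ (n + 1), ∀ m ∈ ⨅ n, P ^ n • (⊤ : Submodule K M), r • m = m := by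
  let S := Algebra.adjoin K (P : Set A)
  have := Algebra.isMulCommutative_adjoin K comm
  have : Algebra.FiniteType K S := by
    obtain ⟨s, rfl⟩ := fg
    exact (Subalgebra.fg_iff_finiteType _).mp ⟨s, (Algebra.adjoin_span K).symm⟩
  have : IsNoetherianRing S := Algebra.FiniteType.isNoetherianRing K S
  let 𝔪 : Ideal S := Ideal.span {r | (r : A) ∈ P}
  have 𝔪_le : ∀ r ∈ 𝔪, (r : A) ∈ ⨆ n, P ^ (n + 1) := by
    have : ⨆ n, P ^ (n + 1) = P * S.toSubmodule := by
      simp only [S, toSubmodule_adjoin_eq_iSup_pow, Submodule.mul_iSup, pow_succ']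
    rw [this]
    intro r hr
    induction hr using Submodule.span_induction with
    | mem x hx => exact mul_one (x : A) ▸ Submodule.mul_mem_mul hx S.one_mem
    | zero => exact zero_mem _
    | add x y _ _ hx hy => exact add_mem hx hy
    | smul s x _ hx =>
      rw [smul_eq_mul, mul_comm, ← S.isIdempotentElem_toSubmodule.eq, ← mul_assoc]
      exact Submodule.mul_mem_mul hx s.2
  have pow_le (n : ℕ) (m : M) (hm : m ∈ P ^ n • (⊤ : Submodule K M)) :
      m ∈ (𝔪 ^ n • ⊤ : Submodule S M) := by
    induction n generalizing m with
    | zero => simp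
    | succ n ih =>
      rw [pow_succ', ← smul_eq_mul, Submodule.smul_assoc] at hm
      rw [pow_succ', ← smul_eq_mul, Submodule.smul_assoc]
      induction hm using Submodule.smul_induction_on' with
      | smul p hp x hx =>
        let p' : S := ⟨p, Algebra.subset_adjoin hp⟩
        have : p' ∈ 𝔪 := Ideal.subset_span hp
        exact Submodule.smul_mem_smul this (ih x hx)
      | add x _ y _ hx hy => exact add_mem hx hy
  obtain ⟨r, r_mem, hr⟩ := exists_mem_ideal_smul_eq_self (M := M) 𝔪
  refine ⟨r, 𝔪_le r r_mem, fun m hm => hr m ?_⟩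
  simp only [Submodule.mem_iInf] at hm ⊢
  exact fun n => pow_le n m (hm n)

theorem fg_smul {P : Submodule K A} {V : Submodule K M} (hP : P.FG) (hV : V.FG) : (P • V).FG := by
  have : P • V = Submodule.map₂ (Algebra.lsmul K K M).toLinearMap P V :=
    le_antisymm (Submodule.smul_le.mpr fun _ hp _ hv => Submodule.apply_mem_map₂ _ hp hv)
      (Submodule.map₂_le.mpr fun _ hp _ hv => Submodule.smul_mem_smul hp hv)
  exact this ▸ hP.map₂ _ hV

theorem finite_adjoin_iff_exists_iSup_pow_smul_eq_top {P : Submodule K A} :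
    Module.Finite (Algebra.adjoin K (P : Set A)) M ↔
      ∃ V : Submodule K M, V.FG ∧ ⨆ n, P ^ n • V = ⊤ := by
  have iSup_eq (s : Set M) : ⨆ n, P ^ n • Submodule.span K s =
      (Submodule.span (Algebra.adjoin K (P : Set A)) s).restrictScalars K := by
    rw [← Submodule.iSup_smul, ← toSubmodule_adjoin_eq_iSup_pow]
    refine le_antisymm (Submodule.smul_le.mpr fun a ha m hm => ?_) fun m hm => ?_
    · exact Submodule.smul_mem _ (⟨a, ha⟩ : Algebra.adjoin K (P : Set A))
        (Submodule.span_le_restrictScalars K _ s hm)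
    · induction hm using Submodule.span_induction with
      | mem m hm =>
        exact one_smul A m ▸ Submodule.smul_mem_smul (one_mem (Algebra.adjoin K (P : Set A)))
          (Submodule.subset_span hm)
      | zero => exact zero_mem _
      | add _ _ _ _ hm hm' => exact add_mem hm hm'
      | smul a m _ hm =>
        rw [← (Algebra.adjoin K (P : Set A)).isIdempotentElem_toSubmodule.eq, ← smul_eq_mul,
          Submodule.smul_assoc]
        exact Submodule.smul_mem_smul a.2 hm
  constructor
  · rintro ⟨s, hs⟩
    exact ⟨Submodule.span K s, ⟨s, rfl⟩, by rw [iSup_eq, hs]; rfl⟩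
  · rintro ⟨_, ⟨s, rfl⟩, h⟩
    rw [iSup_eq] at h
    exact ⟨s, (Submodule.restrictScalars_eq_top_iff ..).mp h⟩

end GradedPowers

section SpectralComplement

variable {K M : Type*} [Field K] [AddCommGroup M] [Module K M]

/-- The vectors annihilated by a polynomial in `f` that does not vanish at `z`. For locally finite
`f` this is the sum of the generalized eigenspaces of `f` for the eigenvalues other than `z` (over
an algebraically closed field). -/
def spectralComplement (f : Module.End K M) (z : K) : Submodule K M where
  carrier := {m | ∃ q : K[X], q.eval z ≠ 0 ∧ aeval f q m = 0}
  zero_mem' := ⟨1, by simp, map_zero _⟩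
  add_mem' := by
    rintro m m' ⟨q, hq, hm⟩ ⟨q', hq', hm'⟩
    refine ⟨q * q', by simp [hq, hq'], ?_⟩
    rw [map_add, map_mul, Module.End.mul_apply, Module.End.mul_apply, hm', map_zero, add_zero,
      ← Module.End.mul_apply, ← map_mul, mul_comm, map_mul, Module.End.mul_apply, hm, map_zero]
  smul_mem' := by
    rintro c m ⟨q, hq, hm⟩
    exact ⟨q, hq, by rw [map_smul, hm, smul_zero]⟩

theorem mem_spectralComplement_of_apply_eq_smul {f : Module.End K M} {z μ : K} (h : μ ≠ z) {m : M}
    (hm : f m = μ • m) : m ∈ spectralComplement f z :=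
  ⟨X - C μ, by simpa [sub_eq_zero] using h.symm, by simp [hm]⟩

theorem aeval_apply_of_apply_eq_smul {f : Module.End K M} {z : K} {v : M} (hv : f v = z • v)
    (q : K[X]) : aeval f q v = q.eval z • v := by
  by_cases v_ne : v = 0
  · simp [v_ne]
  · exact Module.End.aeval_apply_of_hasEigenvector
      ⟨Module.End.mem_eigenspace_iff.mpr hv, v_ne⟩

theorem mem_of_add_mem_of_mem_spectralComplement {f : Module.End K M} {z : K} {v m : M}
    {N : Submodule K M} (hN : ∀ x ∈ N, f x ∈ N) (hv : f v = z • v)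
    (hm : m ∈ spectralComplement f z) (h : v + m ∈ N) : v ∈ N := by
  obtain ⟨q, hq, hqm⟩ := hm
  have : q.eval z • v ∈ N := by
    rw [← aeval_apply_of_apply_eq_smul hv, ← add_zero (aeval f q v), ← hqm, ← map_add]
    exact aeval_apply_smul_mem_of_le_comap h q f hN
  exact (N.smul_mem_iff hq).mp this

theorem exists_aeval_apply_mem (f : Module.End K M) {N : Submodule K M}
    (hN : ∀ x ∈ N, f x ∈ N) [Module.Finite K (M ⧸ N)] :
    ∃ p : K[X], p ≠ 0 ∧ ∀ m, aeval f p m ∈ N := by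
  let g : Module.End K (M ⧸ N) := N.mapQ N f hN
  have aeval_g (p : K[X]) (m : M) : aeval g p (N.mkQ m) = N.mkQ (aeval f p m) := by
    induction p using Polynomial.induction_on generalizing m with
    | C c => simp [Module.algebraMap_end_apply]
    | add p q hp hq => simp only [map_add, LinearMap.add_apply, hp, hq]
    | monomial n c ih =>
      rw [pow_succ, ← mul_assoc, map_mul, map_mul (aeval f), Module.End.mul_apply,
        Module.End.mul_apply, aeval_X, aeval_X, ← ih]
      rfl
  refine ⟨minpoly K g, minpoly.ne_zero (Algebra.IsIntegral.isIntegral g), fun m => ?_⟩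
  have := aeval_g (minpoly K g) m
  rwa [minpoly.aeval, LinearMap.zero_apply, eq_comm, Submodule.mkQ_apply,
    Submodule.Quotient.mk_eq_zero] at this

end SpectralComplement

theorem semiconjBy_aeval {K A : Type*} [CommSemiring K] [Semiring A] [Algebra K A] {x a b : A}
    (h : SemiconjBy x a b) (p : K[X]) :
    SemiconjBy x (aeval a p) (aeval b p) := by
  induction p using Polynomial.induction_on' with
  | add p q hp hq => simpa only [map_add] using hp.add_right hq
  | monomial n c =>
    simp only [aeval_monomial]
    exact SemiconjBy.mul_right (Algebra.commutes c x).symm (h.pow_right n)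

theorem exists_forall_ge_isCoprime_comp_X_sub_C {K : Type*} [Field K] [CharZero K] {p q : K[X]}
    (hp : p ≠ 0) (hq : q ≠ 0) : ∃ n : ℕ, ∀ j ≥ n, IsCoprime (p.comp (X - C (j : K))) q := by
  let F := AlgebraicClosure K
  let S : Set ℕ := {j | ∃ z ∈ q.rootSet F, aeval (z - j) p = 0}
  have S_finite : S.Finite := by
    have : S ⊆ ⋃ z ∈ q.rootSet F, (fun j : ℕ => z - (j : F)) ⁻¹' p.rootSet F := by
      rintro j ⟨z, hz, hj⟩
      exact Set.mem_biUnion hz ((mem_rootSet_of_ne hp).mpr hj)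
    refine ((q.rootSet_finite F).biUnion fun z _ => (p.rootSet_finite F).preimage ?_).subset this
    exact (fun i _ j _ h => Nat.cast_injective (sub_right_injective h))
  obtain ⟨n, hn⟩ := S_finite.bddAbove
  refine ⟨n + 1, fun j hj => (isCoprime_iff_aeval_ne_zero_of_isAlgClosed K F _ _).mpr fun z => ?_⟩
  by_contra! h
  have : j ∈ S := ⟨z, (mem_rootSet_of_ne hq).mpr h.2, by simpa [aeval_comp] using h.1⟩
  exact absurd (hn this) (by omega)

/-- A triangular decomposition of a `K`-algebra graded by an inner Euler element: commuting raising
operators `pos`, commuting lowering operators `neg` and a finite-dimensional `base` (the image of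
the group algebra, for a Cherednik algebra), together generating `A`. The conditions are symmetric
under passing to the opposite algebra and exchanging `pos` and `neg`. -/
structure TriangularData (K A : Type*) [Field K] [Ring A] [Algebra K A] where
  pos : Submodule K A
  neg : Submodule K A
  base : Submodule K A
  euler : A
  pos_fg : pos.FG
  neg_fg : neg.FG
  base_fg : base.FG
  pos_comm : ∀ x ∈ pos, ∀ x' ∈ pos, x * x' = x' * x
  neg_comm : ∀ y ∈ neg, ∀ y' ∈ neg, y * y' = y' * y
  one_mem_base : 1 ∈ base
  base_mul_base_le : base * base ≤ base
  base_mul_pos_le : base * pos ≤ pos * base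
  neg_mul_base_le : neg * base ≤ base * neg
  neg_mul_pos_le : neg * pos ≤ pos * neg ⊔ base
  euler_mem : euler ∈ pos * neg ⊔ base
  euler_lie_pos : ∀ x ∈ pos, ⁅euler, x⁆ = x
  euler_lie_neg : ∀ y ∈ neg, ⁅euler, y⁆ = -y
  generates : ∀ S : Subalgebra K A,
    pos ≤ S.toSubmodule → neg ≤ S.toSubmodule → base ≤ S.toSubmodule → S = ⊤

namespace TriangularData

variable {K A M : Type*} [Field K] [Ring A] [Algebra K A] (T : TriangularData K A)
  [AddCommGroup M] [Module K M] [Module A M] [IsScalarTower K A M]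

theorem base_mul_pos_pow_le (n : ℕ) : T.base * T.pos ^ n ≤ T.pos ^ n * T.base := by
  induction n with
  | zero => simp
  | succ n ih =>
    calc T.base * T.pos ^ (n + 1) = T.base * T.pos ^ n * T.pos := by rw [pow_succ, mul_assoc]
      _ ≤ T.pos ^ n * T.base * T.pos := mul_le_mul_left ih _
      _ = T.pos ^ n * (T.base * T.pos) := mul_assoc ..
      _ ≤ T.pos ^ n * (T.pos * T.base) := mul_le_mul_right T.base_mul_pos_le _
      _ = T.pos ^ (n + 1) * T.base := by rw [← mul_assoc, ← pow_succ]

theorem neg_mul_pos_pow_succ_le (n : ℕ) :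
    T.neg * T.pos ^ (n + 1) ≤ T.pos ^ (n + 1) * T.neg ⊔ T.pos ^ n * T.base := by
  induction n with
  | zero => simpa using T.neg_mul_pos_le
  | succ n ih =>
    calc T.neg * T.pos ^ (n + 2) = T.neg * T.pos ^ (n + 1) * T.pos := by
          rw [pow_succ _ (n + 1), mul_assoc]
      _ ≤ (T.pos ^ (n + 1) * T.neg ⊔ T.pos ^ n * T.base) * T.pos := mul_le_mul_left ih _
      _ = T.pos ^ (n + 1) * (T.neg * T.pos) ⊔ T.pos ^ n * (T.base * T.pos) := by
          rw [Submodule.sup_mul, mul_assoc, mul_assoc]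
      _ ≤ T.pos ^ (n + 1) * (T.pos * T.neg ⊔ T.base) ⊔ T.pos ^ n * (T.pos * T.base) :=
          sup_le_sup (mul_le_mul_right T.neg_mul_pos_le _)
            (mul_le_mul_right T.base_mul_pos_le _)
      _ = T.pos ^ (n + 2) * T.neg ⊔ T.pos ^ (n + 1) * T.base := by
          rw [Submodule.mul_sup, ← mul_assoc, ← mul_assoc, ← pow_succ, ← pow_succ, sup_assoc,
            sup_idem]

theorem euler_lie_pos_pow {n : ℕ} {x : A} (hx : x ∈ T.pos ^ n) : ⁅T.euler, x⁆ = (n : K) • x := by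
  induction n generalizing x with
  | zero =>
    obtain ⟨c, rfl⟩ := Submodule.mem_one.mp (by simpa using hx)
    simp [Ring.lie_def, Algebra.commutes]
  | succ n ih =>
    rw [pow_succ'] at hx
    induction hx using Submodule.mul_induction_on' with
    | mem_mul_mem x hx y hy =>
      have : ⁅T.euler, x * y⁆ = ⁅T.euler, x⁆ * y + x * ⁅T.euler, y⁆ := by
        simp only [Ring.lie_def]; noncomm_ring
      rw [this, T.euler_lie_pos x hx, ih hy, mul_smul_comm, Nat.cast_succ, add_smul, one_smul,
        add_comm]
    | add x _ y _ hx hy => rw [lie_add, hx, hy, smul_add]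

theorem smul_mem_of_generators {N : Submodule K M} (hpos : T.pos • N ≤ N) (hneg : T.neg • N ≤ N)
    (hbase : T.base • N ≤ N) (a : A) {m : M} (hm : m ∈ N) : a • m ∈ N := by
  let S : Subalgebra K A :=
    { carrier := {a | ∀ m ∈ N, a • m ∈ N}
      mul_mem' := fun ha hb m hm => by rw [mul_smul]; exact ha _ (hb m hm)
      add_mem' := fun ha hb m hm => by rw [add_smul]; exact N.add_mem (ha m hm) (hb m hm)
      algebraMap_mem' := fun c m hm => by rw [algebraMap_smul]; exact N.smul_mem c hm }
  have le_S {P : Submodule K A} (hP : P • N ≤ N) : P ≤ S.toSubmodule :=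
    fun p hp m hm => hP (Submodule.smul_mem_smul hp hm)
  have : S = ⊤ := T.generates S (le_S hpos) (le_S hneg) (le_S hbase)
  exact (this ▸ Algebra.mem_top : a ∈ S) m hm

theorem iSup_pos_pow_smul_eq_top {V : Submodule K M} (hbase : T.base • V ≤ V) (hneg : T.neg • V ≤ V)
    (span_eq : Submodule.span A (V : Set M) = ⊤) : ⨆ n, T.pos ^ n • V = ⊤ := by
  let N := ⨆ n, T.pos ^ n • V
  have le_N (n : ℕ) : T.pos ^ n • V ≤ N := le_iSup (fun n => T.pos ^ n • V) n
  have base_le (n : ℕ) : T.pos ^ n • T.base • V ≤ N :=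
    (Submodule.smul_mono le_rfl hbase).trans (le_N n)
  have pos_smul : T.pos • N ≤ N := by
    simp only [N, Submodule.smul_iSup, ← Submodule.smul_assoc, smul_eq_mul, ← pow_succ']
    exact iSup_le fun n => le_N (n + 1)
  have base_smul : T.base • N ≤ N := by
    rw [Submodule.smul_iSup]
    refine iSup_le fun n => ?_
    rw [← Submodule.smul_assoc]
    refine (Submodule.smul_mono_left (T.base_mul_pos_pow_le n)).trans ?_
    rw [← smul_eq_mul, Submodule.smul_assoc]
    exact base_le n
  have neg_smul : T.neg • N ≤ N := by
    rw [Submodule.smul_iSup]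
    refine iSup_le fun n => ?_
    cases n with
    | zero =>
      rw [pow_zero, Submodule.one_smul]
      exact hneg.trans (by simpa only [pow_zero, Submodule.one_smul] using le_N 0)
    | succ n =>
      rw [← Submodule.smul_assoc]
      refine (Submodule.smul_mono_left (T.neg_mul_pos_pow_succ_le n)).trans ?_
      rw [Submodule.sup_smul, ← smul_eq_mul, ← smul_eq_mul, Submodule.smul_assoc,
        Submodule.smul_assoc]
      exact sup_le ((Submodule.smul_mono le_rfl hneg).trans (le_N (n + 1))) (base_le n)
  have V_le : V ≤ N := by simpa only [pow_zero, Submodule.one_smul] using le_N 0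
  refine eq_top_iff.mpr fun m _ => ?_
  have hm : m ∈ Submodule.span A (V : Set M) := span_eq ▸ Submodule.mem_top
  induction hm using Submodule.span_induction with
  | mem m hm => exact V_le hm
  | zero => exact zero_mem _
  | add _ _ _ _ hm hm' => exact add_mem (hm trivial) (hm' trivial)
  | smul a m _ hm => exact T.smul_mem_of_generators pos_smul neg_smul base_smul a (hm trivial)

theorem euler_smul_smul {n : ℕ} {x : A} (hx : x ∈ T.pos ^ n) (m : M) :
    T.euler • x • m = x • T.euler • m + (n : K) • x • m := by
  rw [← mul_smul, ← mul_smul, ← smul_assoc, ← T.euler_lie_pos_pow hx, Ring.lie_def, ← add_smul,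
    add_sub_cancel]

variable (M) in
/-- The filtration of a module by the images of the powers of `pos`. -/
def fil (n : ℕ) : Submodule K M := T.pos ^ n • ⊤

theorem fil_add (m n : ℕ) : T.fil M (m + n) = T.pos ^ m • T.fil M n := by
  rw [fil, fil, pow_add, ← smul_eq_mul, Submodule.smul_assoc]

theorem fil_antitone : Antitone (T.fil M) :=
  antitone_nat_of_succ_le fun n => by
    rw [T.fil_add n 1, fil]
    exact Submodule.smul_mono le_rfl le_top

theorem euler_smul_mem_fil {n : ℕ} {m : M} (hm : m ∈ T.fil M n) : T.euler • m ∈ T.fil M n := by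
  induction hm using Submodule.smul_induction_on' with
  | smul x hx m _ =>
    rw [T.euler_smul_smul hx]
    exact add_mem (Submodule.smul_mem_smul hx trivial)
      (Submodule.smul_mem _ _ (Submodule.smul_mem_smul hx trivial))
  | add m _ m' _ hm hm' => rw [smul_add]; exact add_mem hm hm'

-- The elements of `A` annihilating the intersection `J` are stable under `ad euler`. They contain
-- `1 - r` with `r` of positive degree (Krull), hence also its component `1` of degree zero.
theorem iInf_fil_eq_bot [CharZero K] [Module.Finite (Algebra.adjoin K (T.pos : Set A)) M] :
    ⨅ n, T.fil M n = ⊥ := by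
  set J := ⨅ n, T.fil M n
  obtain ⟨r, hr, r_smul⟩ : ∃ r ∈ ⨆ n, T.pos ^ (n + 1), ∀ m ∈ J, r • m = m :=
    exists_mem_iSup_pow_smul_eq_self T.pos_fg T.pos_comm
  let adEuler : Module.End K A := LieAlgebra.ad K A T.euler
  have euler_J {m : M} (hm : m ∈ J) : T.euler • m ∈ J := by
    simp only [J, Submodule.mem_iInf] at hm ⊢
    exact fun n => T.euler_smul_mem_fil (hm n)
  let N : Submodule K A :=
    { carrier := {a | ∀ m ∈ J, a • m = 0}
      zero_mem' := by simp
      add_mem' := fun ha hb m hm => by rw [add_smul, ha m hm, hb m hm, add_zero]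
      smul_mem' := fun c a ha m hm => by rw [smul_assoc, ha m hm, smul_zero] }
  have adEuler_N : ∀ a ∈ N, adEuler a ∈ N := fun a ha m hm => by
    rw [LieAlgebra.ad_apply, Ring.lie_def, sub_smul, mul_smul, mul_smul, ha m hm,
      ha _ (euler_J hm), smul_zero, sub_zero]
  have le_spectralComplement : ⨆ n, T.pos ^ (n + 1) ≤ spectralComplement adEuler 0 :=
    iSup_le fun n _ hx => mem_spectralComplement_of_apply_eq_smul
      (Nat.cast_ne_zero.mpr n.succ_ne_zero) (T.euler_lie_pos_pow hx)
  have one_mem : 1 ∈ N := by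
    refine mem_of_add_mem_of_mem_spectralComplement (z := 0) adEuler_N ?_
      (neg_mem (le_spectralComplement hr)) fun m hm => ?_
    · simp [adEuler, Ring.lie_def]
    · rw [add_smul, neg_smul, one_smul, r_smul m hm, add_neg_cancel]
  exact (Submodule.eq_bot_iff _).mpr fun m hm => by simpa using one_mem m hm

theorem map_mem_fil {M' : Type*} [AddCommGroup M'] [Module K M'] [Module A M']
    [IsScalarTower K A M'] (f : M →ₗ[A] M') {n : ℕ} {m : M} (hm : m ∈ T.fil M n) :
    f m ∈ T.fil M' n := by
  induction hm using Submodule.smul_induction_on' with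
  | smul x hx m _ => exact map_smul f x m ▸ Submodule.smul_mem_smul hx trivial
  | add _ _ _ _ hm hm' => exact map_add f _ _ ▸ add_mem hm hm'

theorem iInf_sup_fil [CharZero K] [Module.Finite (Algebra.adjoin K (T.pos : Set A)) M]
    (N : Submodule A M) :
    ⨅ n, N.restrictScalars K ⊔ T.fil M n = N.restrictScalars K := by
  refine le_antisymm (fun m hm => ?_) (le_iInf fun n => le_sup_left)
  have : Module.Finite (Algebra.adjoin K (T.pos : Set A)) (M ⧸ N) :=
    Module.Finite.of_surjective (N.mkQ.restrictScalars (Algebra.adjoin K (T.pos : Set A)))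
      N.mkQ_surjective
  have mkQ_mem : N.mkQ m ∈ ⨅ n, T.fil (M ⧸ N) n := by
    refine (Submodule.mem_iInf _).mpr fun n => ?_
    obtain ⟨x, hx, y, hy, rfl⟩ := Submodule.mem_sup.mp ((Submodule.mem_iInf _).mp hm n)
    have : N.mkQ x = 0 := (Submodule.Quotient.mk_eq_zero N).mpr hx
    rw [map_add, this, zero_add]
    exact T.map_mem_fil N.mkQ hy
  rwa [iInf_fil_eq_bot, Submodule.mem_bot, Submodule.mkQ_apply,
    Submodule.Quotient.mk_eq_zero] at mkQ_mem

theorem finite_quotient_fil [Module.Finite (Algebra.adjoin K (T.pos : Set A)) M] (n : ℕ) :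
    Module.Finite K (M ⧸ T.fil M n) := by
  obtain ⟨V, V_fg, hV⟩ := finite_adjoin_iff_exists_iSup_pow_smul_eq_top.mp
    ‹Module.Finite (Algebra.adjoin K (T.pos : Set A)) M›
  let U : Submodule K M := ⨆ i : Fin n, T.pos ^ (i : ℕ) • V
  have U_fg : U.FG := Submodule.fg_iSup _ fun i => fg_smul (T.pos_fg.pow i) V_fg
  have sup_eq : U ⊔ T.fil M n = ⊤ := by
    rw [eq_top_iff, ← hV]
    refine iSup_le fun i => ?_
    rcases lt_or_ge i n with hi | hi
    · exact (le_iSup (fun i : Fin n => T.pos ^ (i : ℕ) • V) ⟨i, hi⟩).trans le_sup_left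
    · exact (Submodule.smul_mono le_rfl le_top).trans ((T.fil_antitone hi).trans le_sup_right)
  have map_eq : U.map (T.fil M n).mkQ = ⊤ := by
    rw [← Submodule.range_mkQ (T.fil M n), LinearMap.range_eq_map, ← sup_eq, Submodule.map_sup,
      Submodule.mkQ_map_self, sup_bot_eq]
  exact Module.finite_def.mpr (map_eq ▸ U_fg.map _)

theorem aeval_euler_smul_mem {N : Submodule K M} (hN : ∀ m ∈ N, T.euler • m ∈ N) (p : K[X]) {m : M}
    (hm : m ∈ N) : aeval T.euler p • m ∈ N := by
  have := aeval_apply_smul_mem_of_le_comap hm p (Algebra.lsmul K K M T.euler) hN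
  rwa [aeval_algHom_apply] at this

theorem exists_aeval_euler_smul_mem_fil_one [Module.Finite (Algebra.adjoin K (T.pos : Set A)) M] :
    ∃ p : K[X], p ≠ 0 ∧ ∀ m : M, aeval T.euler p • m ∈ T.fil M 1 := by
  have := T.finite_quotient_fil (M := M) 1
  obtain ⟨p, p_ne, hp⟩ := exists_aeval_apply_mem (Algebra.lsmul K K M T.euler)
    (N := T.fil M 1) fun m hm => T.euler_smul_mem_fil hm
  refine ⟨p, p_ne, fun m => ?_⟩
  have := hp m
  rwa [aeval_algHom_apply] at this

theorem exists_aeval_euler_mem_fil_one :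
    ∃ q : K[X], q ≠ 0 ∧ aeval T.euler q ∈ T.fil A 1 := by
  obtain ⟨u, hu, κ, hκ, euler_eq⟩ := Submodule.mem_sup.mp T.euler_mem
  have κ_integral : IsIntegral K κ :=
    IsIntegral.of_mem_of_fg (T.base.toSubalgebra T.one_mem_base fun _ _ hx hy =>
      T.base_mul_base_le (Submodule.mul_mem_mul hx hy)) T.base_fg κ hκ
  have sub_mem : T.euler - κ ∈ T.fil A 1 := by
    rw [← euler_eq, add_sub_cancel_right, fil, pow_one]
    exact Submodule.smul_mono le_rfl le_top hu
  have mul_mem {a : A} (ha : a ∈ T.fil A 1) (b : A) : a * b ∈ T.fil A 1 :=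
    T.map_mem_fil (LinearMap.toSpanSingleton A A b) ha
  have aeval_sub_mem (q : K[X]) : aeval T.euler q - aeval κ q ∈ T.fil A 1 := by
    induction q using Polynomial.induction_on with
    | C c => simp
    | add p q hp hq => simpa only [map_add, add_sub_add_comm] using add_mem hp hq
    | monomial n c ih =>
      have : aeval T.euler (C c * X ^ (n + 1)) - aeval κ (C c * X ^ (n + 1)) =
          T.euler • (aeval T.euler (C c * X ^ n) - aeval κ (C c * X ^ n)) +
            (T.euler - κ) * aeval κ (C c * X ^ n) := by
        rw [pow_succ', mul_left_comm, map_mul (aeval T.euler) X, map_mul (aeval κ) X, aeval_X,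
          aeval_X, smul_eq_mul]
        noncomm_ring
      rw [this]
      exact add_mem (T.euler_smul_mem_fil ih) (mul_mem sub_mem _)
  refine ⟨minpoly K κ, minpoly.ne_zero κ_integral, ?_⟩
  simpa using aeval_sub_mem (minpoly K κ)

theorem aeval_comp_smul_mem_fil_succ {p : K[X]} (hp : ∀ m : M, aeval T.euler p • m ∈ T.fil M 1)
    {j : ℕ} {m : M} (hm : m ∈ T.fil M j) :
    aeval T.euler (p.comp (X - C (j : K))) • m ∈ T.fil M (j + 1) := by
  induction hm using Submodule.smul_induction_on' with
  | add m _ m' _ hm hm' => rw [smul_add]; exact add_mem hm hm'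
  | smul x hx m _ =>
    have euler_mul : (T.euler - algebraMap K A j) * x = x * T.euler := by
      rw [sub_mul, ← Algebra.smul_def, ← T.euler_lie_pos_pow hx, Ring.lie_def, sub_sub_cancel]
    have aeval_mul : aeval T.euler (p.comp (X - C (j : K))) * x = x * aeval T.euler p := by
      rw [aeval_comp, map_sub, aeval_X, aeval_C]
      exact (semiconjBy_aeval euler_mul.symm p).eq.symm
    rw [← mul_smul, aeval_mul, mul_smul, fil_add]
    exact Submodule.smul_mem_smul hx (hp m)

theorem le_sup_fil_succ {N N' : Submodule A M} {p q : K[X]} {j : ℕ}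
    (hp : ∀ m : M, aeval T.euler p • m ∈ T.fil M 1) (hq : aeval T.euler q ∈ T.fil A 1)
    (coprime : IsCoprime (p.comp (X - C (j : K))) q)
    (h : N'.restrictScalars K ≤ N.restrictScalars K ⊔ T.fil M j) :
    N'.restrictScalars K ≤ N.restrictScalars K ⊔ T.fil M (j + 1) := by
  have euler_stable : ∀ m ∈ N.restrictScalars K ⊔ T.fil M (j + 1),
      T.euler • m ∈ N.restrictScalars K ⊔ T.fil M (j + 1) := fun m hm => by
    obtain ⟨x, hx, y, hy, rfl⟩ := Submodule.mem_sup.mp hm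
    rw [smul_add]
    exact Submodule.add_mem_sup (N.smul_mem _ hx) (T.euler_smul_mem_fil hy)
  have p_smul_mem {m : M} (hm : m ∈ N') :
      aeval T.euler (p.comp (X - C (j : K))) • m ∈ N.restrictScalars K ⊔ T.fil M (j + 1) := by
    obtain ⟨x, hx, y, hy, rfl⟩ := Submodule.mem_sup.mp (h hm)
    rw [smul_add]
    exact Submodule.add_mem_sup (N.smul_mem _ hx) (T.aeval_comp_smul_mem_fil_succ hp hy)
  have q_smul_mem {m : M} (hm : m ∈ N') :
      aeval T.euler q • m ∈ N.restrictScalars K ⊔ T.fil M (j + 1) := by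
    have : T.fil A 1 • N'.restrictScalars K ≤ N.restrictScalars K ⊔ T.fil M (j + 1) :=
      calc T.fil A 1 • N'.restrictScalars K
          = T.pos • (⊤ : Submodule K A) • N'.restrictScalars K := by
            rw [fil, pow_one, Submodule.smul_assoc]
        _ ≤ T.pos • N'.restrictScalars K :=
            Submodule.smul_mono le_rfl (Submodule.smul_le.mpr fun a _ m hm => N'.smul_mem a hm)
        _ ≤ T.pos • (N.restrictScalars K ⊔ T.fil M j) := Submodule.smul_mono le_rfl h
        _ ≤ N.restrictScalars K ⊔ T.fil M (j + 1) := by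
            rw [Submodule.smul_sup, add_comm j, fil_add, pow_one]
            exact sup_le_sup (Submodule.smul_le.mpr fun a _ m hm => N.smul_mem a hm) le_rfl
    exact this (Submodule.smul_mem_smul hq hm)
  intro m hm
  obtain ⟨a, b, hab⟩ := coprime
  have : m = aeval T.euler a • aeval T.euler (p.comp (X - C (j : K))) • m +
      aeval T.euler b • aeval T.euler q • m := by
    rw [← mul_smul, ← mul_smul, ← map_mul, ← map_mul, ← add_smul, ← map_add, hab, map_one, one_smul]
  rw [this]
  exact add_mem (T.aeval_euler_smul_mem euler_stable a (p_smul_mem hm))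
    (T.aeval_euler_smul_mem euler_stable b (q_smul_mem hm))

theorem exists_forall_le_sup_fil_imp_le [CharZero K]
    [Module.Finite (Algebra.adjoin K (T.pos : Set A)) M] :
    ∃ n, ∀ N N' : Submodule A M,
      N'.restrictScalars K ≤ N.restrictScalars K ⊔ T.fil M n → N' ≤ N := by
  obtain ⟨p, p_ne, hp⟩ := T.exists_aeval_euler_smul_mem_fil_one (M := M)
  obtain ⟨q, q_ne, hq⟩ := T.exists_aeval_euler_mem_fil_one
  obtain ⟨n, coprime⟩ := exists_forall_ge_isCoprime_comp_X_sub_C p_ne q_ne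
  refine ⟨n, fun N N' h => ?_⟩
  have le_sup (j : ℕ) (hj : n ≤ j) : N'.restrictScalars K ≤ N.restrictScalars K ⊔ T.fil M j := by
    induction j, hj using Nat.le_induction with
    | base => exact h
    | succ j hj ih => exact T.le_sup_fil_succ hp hq (coprime j hj) ih
  change N'.restrictScalars K ≤ N.restrictScalars K
  rw [← T.iInf_sup_fil N]
  exact le_iInf fun j => (le_sup (max n j) (le_max_left ..)).trans
    (sup_le_sup le_rfl (T.fil_antitone (le_max_right ..)))

theorem isFiniteLength [CharZero K] [Module.Finite (Algebra.adjoin K (T.pos : Set A)) M] :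
    IsFiniteLength A M := by
  obtain ⟨n, hn⟩ := T.exists_forall_le_sup_fil_imp_le (M := M)
  have := T.finite_quotient_fil (M := M) n
  let F (N : Submodule A M) : Submodule K (M ⧸ T.fil M n) :=
    (N.restrictScalars K).map (T.fil M n).mkQ
  have F_le {N N' : Submodule A M} (h : F N' ≤ F N) : N' ≤ N := by
    refine hn N N' ((Submodule.map_le_iff_le_comap.mp h).trans ?_)
    rw [Submodule.comap_map_mkQ, sup_comm]
  have F_strictMono : StrictMono F := fun N N' h =>
    lt_of_le_not_ge (Submodule.map_mono h.le) fun h' => h.not_ge (F_le h')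
  exact isFiniteLength_iff_isNoetherian_isArtinian.mpr
    ⟨isNoetherian_iff'.mpr F_strictMono.wellFoundedGT, F_strictMono.wellFoundedLT⟩

end TriangularData

section TensorProduct

variable {K A B : Type*} [CommRing K] [Ring A] [Algebra K A] [Ring B] [Algebra K B]

/-- The subspace of `A ⊗ B` spanned by the pure tensors with factors in given subspaces. -/
def tmulSpan (P : Submodule K A) (Q : Submodule K B) : Submodule K (A ⊗[K] B) :=
  Submodule.map₂ (TensorProduct.mk K A B) P Q

theorem tmul_mem_tmulSpan {P : Submodule K A} {Q : Submodule K B} {a : A} {b : B} (ha : a ∈ P)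
    (hb : b ∈ Q) : a ⊗ₜ b ∈ tmulSpan P Q :=
  Submodule.apply_mem_map₂ _ ha hb

theorem tmul_one_mem_tmulSpan {P : Submodule K A} {a : A} (ha : a ∈ P) :
    a ⊗ₜ (1 : B) ∈ tmulSpan P 1 :=
  tmul_mem_tmulSpan ha (Submodule.one_le.mp le_rfl)

theorem one_tmul_mem_tmulSpan {Q : Submodule K B} {b : B} (hb : b ∈ Q) :
    (1 : A) ⊗ₜ b ∈ tmulSpan 1 Q :=
  tmul_mem_tmulSpan (Submodule.one_le.mp le_rfl) hb

theorem fg_tmulSpan_sup {P : Submodule K A} {Q : Submodule K B} (hP : P.FG) (hQ : Q.FG) :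
    (tmulSpan P 1 ⊔ tmulSpan 1 Q).FG := by
  rw [Submodule.one_eq_span, Submodule.one_eq_span]
  exact (hP.map₂ _ (Submodule.fg_span_singleton _)).sup
    ((Submodule.fg_span_singleton _).map₂ _ hQ)

theorem tmulSpan_mono {P P' : Submodule K A} {Q Q' : Submodule K B} (hP : P ≤ P') (hQ : Q ≤ Q') :
    tmulSpan P Q ≤ tmulSpan P' Q' :=
  Submodule.map₂_le_map₂ hP hQ

theorem tmulSpan_mul_tmulSpan (P P' : Submodule K A) (Q Q' : Submodule K B) :
    tmulSpan P Q * tmulSpan P' Q' = tmulSpan (P * P') (Q * Q') := by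
  apply le_antisymm
  · rw [tmulSpan, tmulSpan, Submodule.map₂_eq_span_image2, Submodule.map₂_eq_span_image2,
      Submodule.span_mul_span, Submodule.span_le]
    rintro _ ⟨_, ⟨a, ha, b, hb, rfl⟩, _, ⟨a', ha', b', hb', rfl⟩, rfl⟩
    simpa using tmul_mem_tmulSpan (Submodule.mul_mem_mul ha ha') (Submodule.mul_mem_mul hb hb')
  · refine Submodule.map₂_le.mpr fun a ha b hb => ?_
    induction ha using Submodule.mul_induction_on' with
    | add _ _ _ _ h h' => rw [map_add, LinearMap.add_apply]; exact add_mem h h'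
    | mem_mul_mem p hp p' hp' =>
      induction hb using Submodule.mul_induction_on' with
      | add _ _ _ _ h h' => rw [map_add]; exact add_mem h h'
      | mem_mul_mem q hq q' hq' =>
        simpa using Submodule.mul_mem_mul (tmul_mem_tmulSpan hp hq) (tmul_mem_tmulSpan hp' hq')

theorem exists_tmul_one_eq_of_mem_tmulSpan_one {P : Submodule K A} {t : A ⊗[K] B}
    (ht : t ∈ tmulSpan P 1) : ∃ a ∈ P, a ⊗ₜ 1 = t := by
  have : tmulSpan P (1 : Submodule K B) ≤
      P.map (Algebra.TensorProduct.includeLeft : A →ₐ[K] A ⊗[K] B).toLinearMap := by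
    refine Submodule.map₂_le.mpr fun a ha b hb => ?_
    obtain ⟨z, rfl⟩ := Submodule.mem_one.mp hb
    exact ⟨z • a, P.smul_mem z ha, by
      simp [Algebra.algebraMap_eq_smul_one, TensorProduct.smul_tmul']⟩
  exact this ht

theorem exists_one_tmul_eq_of_mem_one_tmulSpan {Q : Submodule K B} {t : A ⊗[K] B}
    (ht : t ∈ tmulSpan 1 Q) : ∃ b ∈ Q, 1 ⊗ₜ b = t := by
  have : tmulSpan (1 : Submodule K A) Q ≤
      Q.map (Algebra.TensorProduct.includeRight : B →ₐ[K] A ⊗[K] B).toLinearMap := by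
    refine Submodule.map₂_le.mpr fun a ha b hb => ?_
    obtain ⟨z, rfl⟩ := Submodule.mem_one.mp ha
    exact ⟨z • b, Q.smul_mem z hb, by
      simp [Algebra.algebraMap_eq_smul_one, TensorProduct.smul_tmul']⟩
  exact this ht

theorem exists_tmul_one_add_one_tmul_eq {P : Submodule K A} {Q : Submodule K B} {t : A ⊗[K] B}
    (ht : t ∈ tmulSpan P 1 ⊔ tmulSpan 1 Q) : ∃ a ∈ P, ∃ b ∈ Q, a ⊗ₜ 1 + 1 ⊗ₜ b = t := by
  obtain ⟨_, hx, _, hy, rfl⟩ := Submodule.mem_sup.mp ht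
  obtain ⟨a, ha, rfl⟩ := exists_tmul_one_eq_of_mem_tmulSpan_one hx
  obtain ⟨b, hb, rfl⟩ := exists_one_tmul_eq_of_mem_one_tmulSpan hy
  exact ⟨a, ha, b, hb, rfl⟩

theorem tmulSpan_sup_one_le {P N B₁ : Submodule K A} {P' N' B₂ : Submodule K B} (one_mem : 1 ∈ B₂) :
    tmulSpan (P * N ⊔ B₁) 1 ≤
      (tmulSpan P 1 ⊔ tmulSpan 1 P') * (tmulSpan N 1 ⊔ tmulSpan 1 N') ⊔ tmulSpan B₁ B₂ := by
  rw [tmulSpan, Submodule.map₂_sup_left]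
  refine sup_le_sup ?_ (tmulSpan_mono le_rfl (Submodule.one_le.mpr one_mem))
  have : tmulSpan P 1 * tmulSpan N 1 = tmulSpan (P * N) (1 : Submodule K B) := by
    rw [tmulSpan_mul_tmulSpan, one_mul]
  exact this.ge.trans (mul_le_mul' le_sup_left le_sup_left)

theorem tmulSpan_one_sup_le {P N B₁ : Submodule K A} {P' N' B₂ : Submodule K B} (one_mem : 1 ∈ B₁) :
    tmulSpan 1 (P' * N' ⊔ B₂) ≤
      (tmulSpan P 1 ⊔ tmulSpan 1 P') * (tmulSpan N 1 ⊔ tmulSpan 1 N') ⊔ tmulSpan B₁ B₂ := by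
  rw [tmulSpan, Submodule.map₂_sup_right]
  refine sup_le_sup ?_ (tmulSpan_mono (Submodule.one_le.mpr one_mem) le_rfl)
  have : tmulSpan 1 P' * tmulSpan 1 N' = tmulSpan (1 : Submodule K A) (P' * N') := by
    rw [tmulSpan_mul_tmulSpan, one_mul]
  exact this.ge.trans (mul_le_mul' le_sup_right le_sup_right)

theorem commute_of_mem_tmulSpan_sup {P : Submodule K A} {Q : Submodule K B}
    (hP : ∀ a ∈ P, ∀ a' ∈ P, a * a' = a' * a) (hQ : ∀ b ∈ Q, ∀ b' ∈ Q, b * b' = b' * b)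
    (t : A ⊗[K] B) (ht : t ∈ tmulSpan P 1 ⊔ tmulSpan 1 Q) (t' : A ⊗[K] B)
    (ht' : t' ∈ tmulSpan P 1 ⊔ tmulSpan 1 Q) : t * t' = t' * t := by
  obtain ⟨a, ha, b, hb, rfl⟩ := exists_tmul_one_add_one_tmul_eq ht
  obtain ⟨a', ha', b', hb', rfl⟩ := exists_tmul_one_add_one_tmul_eq ht'
  simp only [mul_add, add_mul, Algebra.TensorProduct.tmul_mul_tmul, mul_one, one_mul,
    hP a ha a' ha', hQ b hb b' hb']
  abel

theorem tmul_one_add_one_tmul_lie (e a : A) (e' b : B) :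
    ⁅(e ⊗ₜ 1 + 1 ⊗ₜ e' : A ⊗[K] B), a ⊗ₜ[K] (1 : B) + (1 : A) ⊗ₜ[K] b⁆ =
      ⁅e, a⁆ ⊗ₜ 1 + 1 ⊗ₜ ⁅e', b⁆ := by
  simp only [Ring.lie_def, mul_add, add_mul, Algebra.TensorProduct.tmul_mul_tmul, mul_one, one_mul,
    TensorProduct.sub_tmul, TensorProduct.tmul_sub]
  abel

end TensorProduct

namespace TriangularData

variable {K A B : Type*} [Field K] [Ring A] [Algebra K A] [Ring B] [Algebra K B]

/-- The triangular data of the opposite algebra; raising and lowering operators are exchanged. -/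
protected def op (T : TriangularData K A) : TriangularData K Aᵐᵒᵖ where
  pos := T.neg.map (opLinearEquiv K (M := A)).toLinearMap
  neg := T.pos.map (opLinearEquiv K (M := A)).toLinearMap
  base := T.base.map (opLinearEquiv K (M := A)).toLinearMap
  euler := op T.euler
  pos_fg := T.neg_fg.map _
  neg_fg := T.pos_fg.map _
  base_fg := T.base_fg.map _
  pos_comm := by
    rintro _ ⟨y, hy, rfl⟩ _ ⟨y', hy', rfl⟩
    exact congrArg op (T.neg_comm y' hy' y hy)
  neg_comm := by
    rintro _ ⟨x, hx, rfl⟩ _ ⟨x', hx', rfl⟩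
    exact congrArg op (T.pos_comm x' hx' x hx)
  one_mem_base := ⟨1, T.one_mem_base, rfl⟩
  base_mul_base_le := by
    rw [← Submodule.map_op_mul]
    exact Submodule.map_mono T.base_mul_base_le
  base_mul_pos_le := by
    rw [← Submodule.map_op_mul, ← Submodule.map_op_mul]
    exact Submodule.map_mono T.neg_mul_base_le
  neg_mul_base_le := by
    rw [← Submodule.map_op_mul, ← Submodule.map_op_mul]
    exact Submodule.map_mono T.base_mul_pos_le
  neg_mul_pos_le := by
    rw [← Submodule.map_op_mul, ← Submodule.map_op_mul, ← Submodule.map_sup]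
    exact Submodule.map_mono T.neg_mul_pos_le
  euler_mem := by
    rw [← Submodule.map_op_mul, ← Submodule.map_sup]
    exact Submodule.mem_map_of_mem T.euler_mem
  euler_lie_pos := by
    rintro _ ⟨y, hy, rfl⟩
    apply unop_injective
    simpa [Ring.lie_def, neg_eq_iff_eq_neg] using congrArg Neg.neg (T.euler_lie_neg y hy)
  euler_lie_neg := by
    rintro _ ⟨x, hx, rfl⟩
    apply unop_injective
    simpa [Ring.lie_def] using congrArg Neg.neg (T.euler_lie_pos x hx)
  generates S hpos hneg hbase := by
    have : S.unop = ⊤ := T.generates S.unop (Submodule.map_le_iff_le_comap.mp hneg)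
      (Submodule.map_le_iff_le_comap.mp hpos) (Submodule.map_le_iff_le_comap.mp hbase)
    rw [← Subalgebra.op_unop S, this, Subalgebra.op_top]

theorem eq_top_of_tmulSpan_le {T : TriangularData K A} {S : TriangularData K B}
    {R : Subalgebra K (A ⊗[K] B)} (hpos : tmulSpan T.pos 1 ⊔ tmulSpan 1 S.pos ≤ R.toSubmodule)
    (hneg : tmulSpan T.neg 1 ⊔ tmulSpan 1 S.neg ≤ R.toSubmodule)
    (hbase : tmulSpan T.base S.base ≤ R.toSubmodule) : R = ⊤ := by
  have left_mem (a : A) : a ⊗ₜ 1 ∈ R := by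
    let f : A →ₐ[K] A ⊗[K] B := Algebra.TensorProduct.includeLeft
    have : R.comap f = ⊤ := T.generates _
      (fun a ha => hpos (Submodule.mem_sup_left (tmul_one_mem_tmulSpan ha)))
      (fun a ha => hneg (Submodule.mem_sup_left (tmul_one_mem_tmulSpan ha)))
      (fun a ha => hbase (tmul_mem_tmulSpan ha S.one_mem_base))
    exact (this ▸ Algebra.mem_top : a ∈ R.comap f)
  have right_mem (b : B) : 1 ⊗ₜ b ∈ R := by
    let f : B →ₐ[K] A ⊗[K] B := Algebra.TensorProduct.includeRight
    have : R.comap f = ⊤ := S.generates _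
      (fun b hb => hpos (Submodule.mem_sup_right (one_tmul_mem_tmulSpan hb)))
      (fun b hb => hneg (Submodule.mem_sup_right (one_tmul_mem_tmulSpan hb)))
      (fun b hb => hbase (tmul_mem_tmulSpan T.one_mem_base hb))
    exact (this ▸ Algebra.mem_top : b ∈ R.comap f)
  rw [eq_top_iff, ← Algebra.TensorProduct.adjoin_tmul_eq_top, Algebra.adjoin_le_iff]
  rintro _ ⟨a, b, rfl⟩
  simpa using mul_mem (left_mem a) (right_mem b)

theorem neg_mul_pos_le_tmulSpan (T : TriangularData K A) (S : TriangularData K B) :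
    (tmulSpan T.neg 1 ⊔ tmulSpan 1 S.neg) * (tmulSpan T.pos 1 ⊔ tmulSpan 1 S.pos) ≤
      (tmulSpan T.pos 1 ⊔ tmulSpan 1 S.pos) * (tmulSpan T.neg 1 ⊔ tmulSpan 1 S.neg) ⊔
        tmulSpan T.base S.base := by
  have swap_left : tmulSpan 1 S.neg * tmulSpan T.pos 1 = tmulSpan T.pos 1 * tmulSpan 1 S.neg := by
    simp only [tmulSpan_mul_tmulSpan, one_mul, mul_one]
  have swap_right : tmulSpan T.neg 1 * tmulSpan 1 S.pos = tmulSpan 1 S.pos * tmulSpan T.neg 1 := by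
    simp only [tmulSpan_mul_tmulSpan, one_mul, mul_one]
  rw [Submodule.mul_sup, Submodule.sup_mul, Submodule.sup_mul, swap_left, swap_right,
    tmulSpan_mul_tmulSpan T.neg, tmulSpan_mul_tmulSpan 1 1, one_mul, one_mul]
  refine sup_le (sup_le ?_ ?_) (sup_le ?_ ?_)
  · exact (tmulSpan_mono T.neg_mul_pos_le le_rfl).trans (tmulSpan_sup_one_le S.one_mem_base)
  · exact (mul_le_mul' le_sup_left le_sup_right).trans le_sup_left
  · exact (mul_le_mul' le_sup_right le_sup_left).trans le_sup_left
  · exact (tmulSpan_mono le_rfl S.neg_mul_pos_le).trans (tmulSpan_one_sup_le T.one_mem_base)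

/-- The triangular data of a tensor product of algebras. -/
def tensor (T : TriangularData K A) (S : TriangularData K B) : TriangularData K (A ⊗[K] B) where
  pos := tmulSpan T.pos 1 ⊔ tmulSpan 1 S.pos
  neg := tmulSpan T.neg 1 ⊔ tmulSpan 1 S.neg
  base := tmulSpan T.base S.base
  euler := T.euler ⊗ₜ 1 + 1 ⊗ₜ S.euler
  pos_fg := fg_tmulSpan_sup T.pos_fg S.pos_fg
  neg_fg := fg_tmulSpan_sup T.neg_fg S.neg_fg
  base_fg := T.base_fg.map₂ _ S.base_fg
  pos_comm := commute_of_mem_tmulSpan_sup T.pos_comm S.pos_comm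
  neg_comm := commute_of_mem_tmulSpan_sup T.neg_comm S.neg_comm
  one_mem_base := tmul_mem_tmulSpan T.one_mem_base S.one_mem_base
  base_mul_base_le := by
    rw [tmulSpan_mul_tmulSpan]
    exact tmulSpan_mono T.base_mul_base_le S.base_mul_base_le
  base_mul_pos_le := by
    simp only [Submodule.mul_sup, Submodule.sup_mul, tmulSpan_mul_tmulSpan, one_mul, mul_one]
    exact sup_le_sup (tmulSpan_mono T.base_mul_pos_le le_rfl)
      (tmulSpan_mono le_rfl S.base_mul_pos_le)
  neg_mul_base_le := by
    simp only [Submodule.mul_sup, Submodule.sup_mul, tmulSpan_mul_tmulSpan, one_mul, mul_one]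
    exact sup_le_sup (tmulSpan_mono T.neg_mul_base_le le_rfl)
      (tmulSpan_mono le_rfl S.neg_mul_base_le)
  neg_mul_pos_le := neg_mul_pos_le_tmulSpan T S
  euler_mem := add_mem
    (tmulSpan_sup_one_le S.one_mem_base (tmul_one_mem_tmulSpan T.euler_mem))
    (tmulSpan_one_sup_le T.one_mem_base (one_tmul_mem_tmulSpan S.euler_mem))
  euler_lie_pos t ht := by
    obtain ⟨a, ha, b, hb, rfl⟩ := exists_tmul_one_add_one_tmul_eq ht
    rw [tmul_one_add_one_tmul_lie, T.euler_lie_pos a ha, S.euler_lie_pos b hb]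
  euler_lie_neg t ht := by
    obtain ⟨a, ha, b, hb, rfl⟩ := exists_tmul_one_add_one_tmul_eq ht
    rw [tmul_one_add_one_tmul_lie, T.euler_lie_neg a ha, S.euler_lie_neg b hb,
      TensorProduct.neg_tmul, TensorProduct.tmul_neg, neg_add]
  generates _ hpos hneg hbase := eq_top_of_tmulSpan_le hpos hneg hbase

end TriangularData

section Bimodule

variable {K A : Type*} [CommRing K] [Ring A] [Algebra K A]

attribute [local instance] TensorProduct.Algebra.module

theorem tmul_op_smul (a b x : A) : (a ⊗ₜ[K] op b) • x = a * x * b := by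
  rw [TensorProduct.Algebra.smul_def, op_smul_eq_mul, smul_eq_mul, mul_assoc]

theorem isScalarTower_bimodule : IsScalarTower K (A ⊗[K] Aᵐᵒᵖ) A where
  smul_assoc z t x := by
    induction t using TensorProduct.induction_on with
    | zero =>
      have zero_smul_eq : (0 : A ⊗[K] Aᵐᵒᵖ) • x = 0 := zero_smul (A ⊗[K] Aᵐᵒᵖ) x
      rw [smul_zero, zero_smul_eq, smul_zero]
    | tmul a b =>
      rw [TensorProduct.smul_tmul', TensorProduct.Algebra.smul_def, TensorProduct.Algebra.smul_def,
        smul_assoc]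
    | add s t hs ht => rw [smul_add, add_smul, hs, ht, add_smul, smul_add]

attribute [local instance] isScalarTower_bimodule

variable (K) in
/-- A two-sided ideal of `A` as a sub-bimodule of `A`. -/
def bimoduleOfIdeal (I : Ideal A) [I.IsTwoSided] : Submodule (A ⊗[K] Aᵐᵒᵖ) A where
  carrier := I
  add_mem' := I.add_mem
  zero_mem' := I.zero_mem
  smul_mem' t x hx := by
    induction t using TensorProduct.induction_on with
    | zero =>
      have zero_smul_eq : (0 : A ⊗[K] Aᵐᵒᵖ) • x = 0 := zero_smul (A ⊗[K] Aᵐᵒᵖ) x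
      exact zero_smul_eq ▸ I.zero_mem
    | tmul a b =>
      rw [← op_unop b, tmul_op_smul]
      exact I.mul_mem_right _ (I.mul_mem_left _ hx)
    | add s t hs ht => rw [add_smul]; exact I.add_mem hs ht

theorem tmulSpan_pow {B : Type*} [Ring B] [Algebra K B] (P : Submodule K A) (Q : Submodule K B)
    (n : ℕ) : tmulSpan P Q ^ n = tmulSpan (P ^ n) (Q ^ n) := by
  induction n with
  | zero =>
    simp only [pow_zero, tmulSpan, Submodule.one_eq_span, Submodule.map₂_span_span,
      Set.image2_singleton, TensorProduct.mk_apply, Algebra.TensorProduct.one_def]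
  | succ n ih => rw [pow_succ, pow_succ, pow_succ, ih, tmulSpan_mul_tmulSpan]

namespace TriangularData

variable {K A : Type*} [Field K] [Ring A] [Algebra K A] (T : TriangularData K A)

theorem tmul_one_mem_tensor_op_pos_pow {n : ℕ} {x : A} (hx : x ∈ T.pos ^ n) :
    x ⊗ₜ 1 ∈ (T.tensor T.op).pos ^ n := by
  have : x ⊗ₜ 1 ∈ tmulSpan (T.pos ^ n) (1 : Submodule K Aᵐᵒᵖ) := tmul_one_mem_tmulSpan hx
  rw [← one_pow n, ← tmulSpan_pow] at this
  exact (pow_le_pow_left' le_sup_left n : _ ≤ (T.tensor T.op).pos ^ n) this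

theorem one_tmul_op_mem_tensor_op_pos_pow {n : ℕ} {y : A} (hy : y ∈ T.neg ^ n) :
    1 ⊗ₜ op y ∈ (T.tensor T.op).pos ^ n := by
  have op_mem : op y ∈ T.op.pos ^ n := by
    rw [TriangularData.op, ← Submodule.map_op_pow]
    exact Submodule.mem_map_of_mem hy
  have : 1 ⊗ₜ op y ∈ tmulSpan (1 : Submodule K A) (T.op.pos ^ n) := one_tmul_mem_tmulSpan op_mem
  rw [← one_pow n, ← tmulSpan_pow] at this
  exact (pow_le_pow_left' le_sup_right n : _ ≤ (T.tensor T.op).pos ^ n) this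

theorem iSup_pos_pow_mul_base_mul_neg_pow : ⨆ i, ⨆ j, T.pos ^ i * (T.base * T.neg ^ j) = ⊤ := by
  let V := ⨆ j, T.base * T.neg ^ j
  have le_V (j : ℕ) : T.base * T.neg ^ j ≤ V := le_iSup (fun j => T.base * T.neg ^ j) j
  have base_smul : T.base • V ≤ V := by
    rw [smul_eq_mul, Submodule.mul_iSup]
    refine iSup_le fun j => ?_
    rw [← mul_assoc]
    exact (mul_le_mul_left T.base_mul_base_le _).trans (le_V j)
  have neg_smul : T.neg • V ≤ V := by
    rw [smul_eq_mul, Submodule.mul_iSup]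
    refine iSup_le fun j => ?_
    rw [← mul_assoc]
    refine (mul_le_mul_left T.neg_mul_base_le _).trans ?_
    rw [mul_assoc, ← pow_succ']
    exact le_V (j + 1)
  have one_mem : 1 ∈ V := le_V 0 (by simpa using T.one_mem_base)
  have span_eq : Submodule.span A (V : Set A) = ⊤ :=
    (Ideal.eq_top_iff_one _).mpr (Submodule.subset_span one_mem)
  have := T.iSup_pos_pow_smul_eq_top base_smul neg_smul span_eq
  simpa only [V, smul_eq_mul, Submodule.mul_iSup] using this

theorem finite_bimodule :
    Module.Finite (Algebra.adjoin K ((T.tensor T.op).pos : Set (A ⊗[K] Aᵐᵒᵖ))) A := by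
  refine finite_adjoin_iff_exists_iSup_pow_smul_eq_top.mpr ⟨T.base, T.base_fg, ?_⟩
  rw [eq_top_iff, ← T.iSup_pos_pow_mul_base_mul_neg_pow]
  refine iSup₂_le fun i j => le_trans ?_ (le_iSup _ (i + j))
  rw [← mul_assoc, Submodule.mul_le]
  intro u hu y hy
  induction hu using Submodule.mul_induction_on' with
  | add _ _ _ _ h h' => rw [add_mul]; exact add_mem h h'
  | mem_mul_mem x hx b hb =>
    have : x ⊗ₜ[K] op y ∈ (T.tensor T.op).pos ^ (i + j) := by
      rw [pow_add, ← mul_one x, ← one_mul (op y), ← Algebra.TensorProduct.tmul_mul_tmul]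
      exact Submodule.mul_mem_mul (T.tmul_one_mem_tensor_op_pos_pow hx)
        (T.one_tmul_op_mem_tensor_op_pos_pow hy)
    exact tmul_op_smul (K := K) x y b ▸ Submodule.smul_mem_smul this hb

theorem isFiniteLength_bimodule [CharZero K] (T : TriangularData K A) :
    IsFiniteLength (A ⊗[K] Aᵐᵒᵖ) A :=
  have := T.finite_bimodule
  (T.tensor T.op).isFiniteLength

theorem span_neg_pow_le_fil (n : ℕ) :
    (Ideal.span ((T.neg ^ n : Submodule K A) : Set A)).restrictScalars K ≤
      (T.tensor T.op).fil A n := by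
  intro x hx
  induction hx using Submodule.closure_induction with
  | zero => exact zero_mem _
  | add _ _ _ _ hx hy => exact add_mem hx hy
  | smul_mem a y hy =>
    have : ((1 : A) ⊗ₜ[K] op y) • a = a • y := by rw [tmul_op_smul, one_mul, smul_eq_mul]
    exact this ▸ Submodule.smul_mem_smul (T.one_tmul_op_mem_tensor_op_pos_pow hy) trivial

theorem iInf_sup_span_neg_pow [CharZero K] (I : Ideal A) [I.IsTwoSided] :
    ⨅ n, I ⊔ Ideal.span ((T.neg ^ n : Submodule K A) : Set A) = I := by
  refine le_antisymm (fun x hx => ?_) (le_iInf fun n => le_sup_left)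
  have := T.finite_bimodule
  have mem_iInf : x ∈ ⨅ n, (bimoduleOfIdeal K I).restrictScalars K ⊔ (T.tensor T.op).fil A n := by
    refine (Submodule.mem_iInf _).mpr fun n => ?_
    obtain ⟨b, hb, d, hd, rfl⟩ := Submodule.mem_sup.mp ((Submodule.mem_iInf _).mp hx n)
    exact Submodule.add_mem_sup hb (T.span_neg_pow_le_fil n hd)
  rw [iInf_sup_fil] at mem_iInf
  exact mem_iInf

end TriangularData

end Bimodule

section Prime

theorem finite_setOf_infPrime {α : Type*} [Lattice α] [BoundedOrder α]
    (s : RelSeries {(x, y) : α × α | x ⋖ y}) (head_eq : s.head = ⊥) (last_eq : s.last = ⊤) :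
    {p : α | InfPrime p}.Finite := by
  have exists_index (p : {p : α | InfPrime p}) :
      ∃ i : Fin s.length, s i.castSucc ≤ p ∧ ¬ s i.succ ≤ p := by
    by_contra! h
    have le (i : Fin (s.length + 1)) : s i ≤ p :=
      Fin.induction (head_eq.trans_le bot_le) (fun i hi => h i hi) i
    exact p.2.ne_top (top_le_iff.mp (last_eq ▸ le (Fin.last _)))
  choose index le_index not_le using exists_index
  have le_of_index_eq {p q : {p : α | InfPrime p}} (h : index p = index q) : p.1 ≤ q.1 := by
    have covBy : s (index p).castSucc ⋖ s (index p).succ := s.step (index p)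
    have inf_eq : s (index p).succ ⊓ p = s (index p).castSucc :=
      (covBy.eq_or_eq (le_inf covBy.le (le_index p)) inf_le_left).resolve_right
        fun h => not_le p (inf_eq_left.mp h)
    exact (q.2.inf_le.mp (inf_eq.trans_le (h ▸ le_index q))).resolve_left (h ▸ not_le q)
  refine Set.finite_coe_iff.mp (Finite.of_injective index fun p q h => ?_)
  exact Subtype.ext (le_antisymm (le_of_index_eq h) (le_of_index_eq h.symm))

variable {A : Type u} [Ring A]

theorem isPrimeTwoSidedIdeal_iff {I : Ideal A} (hI : I.IsTwoSided) (hI' : I ≠ ⊤) :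
    IsPrimeTwoSidedIdeal I ↔ ∀ r s : A, (∀ t, r * t * s ∈ I) → r ∈ I ∨ s ∈ I := by
  constructor
  · rintro ⟨-, -, le_or_le⟩ r s mul_mem
    let J : Ideal A :=
      { carrier := {y | ∀ t, r * t * y ∈ I}
        add_mem' := fun hx hy t => by rw [mul_add]; exact I.add_mem (hx t) (hy t)
        zero_mem' := fun t => by simp
        smul_mem' := fun b y hy t => by rw [smul_eq_mul, ← mul_assoc, mul_assoc r]; exact hy _ }
    have hJ : J.IsTwoSided :=
      ⟨fun b hy t => by rw [← mul_assoc]; exact I.mul_mem_right b (hy t)⟩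
    let J' : Ideal A :=
      { carrier := {x | ∀ y ∈ J, x * y ∈ I}
        add_mem' := fun hx hy t ht => by rw [add_mul]; exact I.add_mem (hx t ht) (hy t ht)
        zero_mem' := fun t _ => by simp
        smul_mem' := fun b x hx y hy => by
          rw [smul_eq_mul, mul_assoc]; exact I.mul_mem_left b (hx y hy) }
    have hJ' : J'.IsTwoSided :=
      ⟨fun b hx y hy => by rw [mul_assoc]; exact hx _ (J.mul_mem_left b hy)⟩
    have r_mem : r ∈ J' := fun y hy => mul_one r ▸ hy 1
    exact (le_or_le J' J hJ' hJ (Ideal.mul_le.mpr fun x hx y hy => hx y hy)).imp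
      (fun h => h r_mem) (fun h => h mul_mem)
  · intro mem_or_mem
    refine ⟨hI, hI', fun J J' hJ _ mul_le => ?_⟩
    by_contra! not_le
    obtain ⟨r, hrJ, hr⟩ := SetLike.not_le_iff_exists.mp not_le.1
    obtain ⟨s, hsJ, hs⟩ := SetLike.not_le_iff_exists.mp not_le.2
    exact (mem_or_mem r s fun t => mul_le (Ideal.mul_mem_mul (J.mul_mem_right t hrJ) hsJ)).elim
      hr hs

theorem isPrimeTwoSidedIdeal_annihilator (M : Type*) [AddCommGroup M] [Module A M]
    [IsSimpleModule A M] : IsPrimeTwoSidedIdeal (Module.annihilator A M) := by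
  have := IsSimpleModule.nontrivial A M
  have ne_top : Module.annihilator A M ≠ ⊤ := fun h =>
    not_subsingleton M (Module.annihilator_eq_top_iff.mp h)
  refine (isPrimeTwoSidedIdeal_iff inferInstance ne_top).mpr fun r s mul_mem => ?_
  simp only [Module.mem_annihilator, mul_smul] at mul_mem ⊢
  by_contra! h
  obtain ⟨⟨m, hm⟩, n, hn⟩ := h
  obtain ⟨t, ht⟩ := IsSimpleModule.toSpanSingleton_surjective A hn m
  exact hm (ht ▸ mul_mem t n)

theorem IsPrimitiveIdeal.isPrimeTwoSidedIdeal {I : Ideal A} (h : IsPrimitiveIdeal I) :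
    IsPrimeTwoSidedIdeal I := by
  obtain ⟨L, _, _, _, rfl⟩ := h
  exact isPrimeTwoSidedIdeal_annihilator L

/-- A two-sided ideal as an ideal of the opposite ring. -/
def oppositeIdeal {A : Type*} [Ring A] (I : Ideal A) [I.IsTwoSided] : Ideal Aᵐᵒᵖ where
  carrier := {x | x.unop ∈ I}
  add_mem' := I.add_mem
  zero_mem' := I.zero_mem
  smul_mem' r _ hx := I.mul_mem_right r.unop hx

theorem isPrimeTwoSidedIdeal_oppositeIdeal {I : Ideal A} [I.IsTwoSided] (hI : I ≠ ⊤) :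
    IsPrimeTwoSidedIdeal (oppositeIdeal I) ↔ IsPrimeTwoSidedIdeal I := by
  have isTwoSided : (oppositeIdeal I).IsTwoSided := ⟨fun b hx => I.mul_mem_left b.unop hx⟩
  have ne_top : oppositeIdeal I ≠ ⊤ := fun h => hI <|
    (Ideal.eq_top_iff_one I).mpr ((Ideal.eq_top_iff_one (oppositeIdeal I)).mp h)
  rw [isPrimeTwoSidedIdeal_iff ‹_› hI, isPrimeTwoSidedIdeal_iff isTwoSided ne_top]
  constructor
  · refine fun h r s mul_mem => (h (op s) (op r) fun t => ?_).symm
    have : r * (t.unop * s) ∈ I := mul_assoc r t.unop s ▸ mul_mem t.unop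
    exact this
  · refine fun h r s mul_mem => (h s.unop r.unop fun t => ?_).symm
    have : s.unop * (t * r.unop) ∈ I := mul_mem (op t)
    rwa [← mul_assoc] at this

attribute [local instance] TensorProduct.Algebra.module

theorem infPrime_bimoduleOfIdeal (K : Type*) [CommRing K] [Algebra K A] {I : Ideal A} [I.IsTwoSided]
    (hI : IsPrimeTwoSidedIdeal I) : InfPrime (bimoduleOfIdeal K I) := by
  constructor
  · refine fun h => hI.2.1 ((Ideal.eq_top_iff_one I).mpr ?_)
    have : (1 : A) ∈ bimoduleOfIdeal K I := h.eq_top ▸ Submodule.mem_top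
    exact this
  · intro N N' inf_le
    by_contra! not_le
    obtain ⟨r, hrN, hr⟩ := SetLike.not_le_iff_exists.mp not_le.1
    obtain ⟨s, hsN', hs⟩ := SetLike.not_le_iff_exists.mp not_le.2
    refine ((isPrimeTwoSidedIdeal_iff ‹_› hI.2.1).mp hI r s fun t => inf_le ⟨?_, ?_⟩).elim hr hs
    · have : ((1 : A) ⊗ₜ[K] op (t * s)) • r ∈ N := N.smul_mem _ hrN
      rwa [tmul_op_smul, one_mul, ← mul_assoc] at this
    · have : ((r * t) ⊗ₜ[K] op (1 : A)) • s ∈ N' := N'.smul_mem _ hsN'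
      rwa [tmul_op_smul, mul_one] at this

theorem finite_setOf_isPrimeTwoSidedIdeal {K : Type*} [CommRing K] [Algebra K A]
    (h : IsFiniteLength (A ⊗[K] Aᵐᵒᵖ) A) : {I : Ideal A | IsPrimeTwoSidedIdeal I}.Finite := by
  obtain ⟨s, head_eq, last_eq⟩ := isFiniteLength_iff_exists_compositionSeries.mp h
  have := (finite_setOf_infPrime s head_eq last_eq).to_subtype
  let toInfPrime (I : {I : Ideal A | IsPrimeTwoSidedIdeal I}) :
      {N : Submodule (A ⊗[K] Aᵐᵒᵖ) A | InfPrime N} :=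
    have := I.2.1
    ⟨bimoduleOfIdeal K I.1, infPrime_bimoduleOfIdeal K I.2⟩
  refine Set.finite_coe_iff.mp (Finite.of_injective toInfPrime fun I J h => ?_)
  exact Subtype.ext (SetLike.ext fun x => SetLike.ext_iff.mp (congrArg Subtype.val h) x)

end Prime

section LocallyNilpotent

variable {K A M : Type*} [CommRing K] [Ring A] [Algebra K A] {P : Submodule K A}
  [AddCommGroup M] [Module A M]

/-- Every vector of `M` is killed by all products of sufficiently many elements of `P`. -/
def IsLocallyNilpotentOn (P : Submodule K A) (M : Type*) [AddCommGroup M] [Module A M] : Prop :=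
  ∀ m : M, ∃ n, ∀ b ∈ P ^ n, b • m = 0

theorem IsLocallyNilpotentOn.submodule (h : IsLocallyNilpotentOn P M) (N : Submodule A M) :
    IsLocallyNilpotentOn P N := fun m =>
  (h m).imp fun _ smul_eq_zero b hb => Subtype.ext (smul_eq_zero b hb)

theorem IsLocallyNilpotentOn.quotient (h : IsLocallyNilpotentOn P M) (N : Submodule A M) :
    IsLocallyNilpotentOn P (M ⧸ N) := fun m => by
  obtain ⟨m, rfl⟩ := N.mkQ_surjective m
  exact (h m).imp fun _ smul_eq_zero b hb => by rw [← map_smul, smul_eq_zero b hb, map_zero]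

theorem IsLocallyNilpotentOn.exists_ne_zero_forall_smul_eq_zero [Nontrivial M]
    (h : IsLocallyNilpotentOn P M) : ∃ m : M, m ≠ 0 ∧ ∀ b ∈ P, b • m = 0 := by
  classical
  obtain ⟨m, m_ne⟩ := exists_ne (0 : M)
  obtain ⟨k, hk⟩ : ∃ k, Nat.find (h m) = k + 1 := by
    refine Nat.exists_eq_succ_of_ne_zero fun find_eq => m_ne ?_
    have := Nat.find_spec (h m) 1 (by rw [find_eq, pow_zero]; exact Submodule.one_le.mp le_rfl)
    rwa [one_smul] at this
  have not_killed := Nat.find_min (h m) (m := k) (by omega)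
  push Not at not_killed
  obtain ⟨b, hb, smul_ne⟩ := not_killed
  refine ⟨b • m, smul_ne, fun b' hb' => ?_⟩
  rw [← mul_smul]
  exact Nat.find_spec (h m) _ (by rw [hk, pow_succ']; exact Submodule.mul_mem_mul hb' hb)

theorem smul_eq_zero_of_mem_mul {Q : Submodule K A} {m : M} (hQ : ∀ b ∈ Q, b • m = 0) {a : A}
    (ha : a ∈ P * Q) : a • m = 0 := by
  induction ha using Submodule.mul_induction_on' with
  | mem_mul_mem a _ b hb => rw [mul_smul, hQ b hb, smul_zero]
  | add _ _ _ _ ha hb => rw [add_smul, ha, hb, add_zero]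

theorem list_prod_mem_iSup_pow {l : List A}
    (hl : ∀ a ∈ l, a ∈ NonUnitalAlgebra.adjoin K (P : Set A)) :
    l.prod ∈ ⨆ k, P ^ (k + l.length) := by
  have mem_iSup_pow_succ {a : A} (ha : a ∈ NonUnitalAlgebra.adjoin K (P : Set A)) :
      a ∈ ⨆ k, P ^ (k + 1) := by
    induction ha using NonUnitalAlgebra.adjoin_induction with
    | mem a ha => exact Submodule.mem_iSup_of_mem 0 (by simpa using ha)
    | zero => exact zero_mem _
    | add _ _ _ _ ha hb => exact add_mem ha hb
    | smul z _ _ ha => exact Submodule.smul_mem _ z ha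
    | mul a b _ _ ha hb =>
      have : (⨆ k, P ^ (k + 1)) * ⨆ k, P ^ (k + 1) ≤ ⨆ k, P ^ (k + 1) := by
        simp only [Submodule.iSup_mul, Submodule.mul_iSup, ← pow_add]
        exact iSup₂_le fun i j => le_iSup (fun k => P ^ (k + 1)) (j + 1 + i)
      exact this (Submodule.mul_mem_mul ha hb)
  induction l with
  | nil => exact Submodule.mem_iSup_of_mem 0 (by simpa using ⟨1, map_one _⟩)
  | cons a l ih =>
    rw [List.forall_mem_cons] at hl
    have : (⨆ k, P ^ (k + 1)) * ⨆ k, P ^ (k + l.length) ≤ ⨆ k, P ^ (k + (a :: l).length) := by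
      simp only [Submodule.iSup_mul, Submodule.mul_iSup, ← pow_add, List.length_cons]
      refine iSup₂_le fun i j => le_iSup_of_le (i + j) (le_of_eq ?_)
      congr 1
      ring
    rw [List.prod_cons]
    exact this (Submodule.mul_mem_mul (mem_iSup_pow_succ hl.1) (ih hl.2))

end LocallyNilpotent

section ProductsOfLists

variable {K : Type*} {A M : Type u} [CommRing K] [Ring A] [Algebra K A] {P : Submodule K A}
  [AddCommGroup M] {S : Set A}

theorem IsLocallyNilpotentOn.leftLocallyNilpotent [Module A M] (h : IsLocallyNilpotentOn P M)
    (hS : S ⊆ NonUnitalAlgebra.adjoin K (P : Set A)) : LeftLocallyNilpotent S M := by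
  refine fun m => (h m).imp fun n smul_eq_zero l length_eq hl => ?_
  have prod_mem := list_prod_mem_iSup_pow fun a ha => hS (hl a ha)
  rw [length_eq] at prod_mem
  generalize l.prod = a at prod_mem ⊢
  induction prod_mem using Submodule.iSup_induction' with
  | zero => exact zero_smul A m
  | add _ _ _ _ ha hb => rw [add_smul, ha, hb, add_zero]
  | mem k a ha => exact smul_eq_zero_of_mem_mul smul_eq_zero (pow_add P k n ▸ ha)

theorem IsLocallyNilpotentOn.rightLocallyNilpotent [Module Aᵐᵒᵖ M]
    (h : IsLocallyNilpotentOn (P.map (opLinearEquiv K (M := A)).toLinearMap) M)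
    (hS : S ⊆ NonUnitalAlgebra.adjoin K (P : Set A)) : RightLocallyNilpotent S M := by
  refine fun m => (h m).imp fun n smul_eq_zero l length_eq hl => ?_
  have prod_mem := list_prod_mem_iSup_pow fun a ha => hS (hl a ha)
  rw [length_eq] at prod_mem
  generalize l.prod = a at prod_mem ⊢
  induction prod_mem using Submodule.iSup_induction' with
  | zero => rw [op_zero, zero_smul]
  | add _ _ _ _ ha hb => rw [op_add, add_smul, ha, hb, add_zero]
  | mem k a ha =>
    rw [add_comm, pow_add] at ha
    induction ha using Submodule.mul_induction_on' with
    | mem_mul_mem a ha b _ =>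
      have : op a ∈ P.map (opLinearEquiv K (M := A)).toLinearMap ^ n := by
        rw [← Submodule.map_op_pow]
        exact Submodule.mem_map_of_mem ha
      rw [op_mul, mul_smul, smul_eq_zero _ this, smul_zero]
    | add _ _ _ _ ha hb => rw [op_add, add_smul, ha, hb, add_zero]

end ProductsOfLists

section PrimeAnnihilator

variable {K : Type*} {A : Type u} [CommRing K] [Ring A] [Algebra K A] {P : Submodule K A}

theorem exists_isSimpleModule_annihilator_le {I : Ideal A} (hI : IsPrimeTwoSidedIdeal I)
    {M : Type u} [AddCommGroup M] [Module A M] (hM : IsFiniteLength A M)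
    (nilpotent : IsLocallyNilpotentOn P M) (annihilator_le : Module.annihilator A M ≤ I) :
    ∃ (L : Type u) (_ : AddCommGroup L) (_ : Module A L), IsSimpleModule A L ∧
      IsLocallyNilpotentOn P L ∧ Module.annihilator A M ≤ Module.annihilator A L ∧
      Module.annihilator A L ≤ I := by
  induction hM with
  | of_subsingleton =>
    have annihilator_eq := (Module.annihilator_eq_top_iff (R := A)).mpr ‹Subsingleton _›
    exact absurd (top_le_iff.mp (annihilator_eq.ge.trans annihilator_le)) hI.2.1
  | @of_simple_quotient M _ _ N _ _ ih =>
    have annihilator_mul_le : Module.annihilator A N * Module.annihilator A (M ⧸ N) ≤ I := by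
      refine (Ideal.mul_le.mpr fun a ha b hb => ?_).trans annihilator_le
      rw [Module.mem_annihilator] at ha hb ⊢
      intro m
      have : b • m ∈ N := (Submodule.Quotient.mk_eq_zero N).mp (hb (N.mkQ m))
      rw [mul_smul]
      exact congrArg Subtype.val (ha ⟨b • m, this⟩)
    rcases hI.2.2 _ _ inferInstance inferInstance annihilator_mul_le with le | le
    · obtain ⟨L, _, _, simple, nil, ann_le, le_I⟩ := ih (nilpotent.submodule N) le
      have := N.subtype.annihilator_le_of_injective N.injective_subtype
      exact ⟨L, _, _, simple, nil, this.trans ann_le, le_I⟩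
    · have := N.mkQ.annihilator_le_of_surjective N.mkQ_surjective
      exact ⟨M ⧸ N, _, _, ‹_›, nilpotent.quotient N, this, le⟩

end PrimeAnnihilator

namespace TriangularData

section LocallyNilpotentModules

variable {K A M : Type*} [Field K] [Ring A] [Algebra K A] (T : TriangularData K A)
  [AddCommGroup M] [Module A M]

theorem neg_pow_mul_base_le (n : ℕ) : T.neg ^ n * T.base ≤ T.base * T.neg ^ n := by
  have := T.op.base_mul_pos_pow_le n
  simp only [TriangularData.op, ← Submodule.map_op_pow, ← Submodule.map_op_mul] at this
  exact (Submodule.map_le_map_iff_of_injective (opLinearEquiv K).injective _ _).mp this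

theorem neg_pow_succ_mul_pos_le (n : ℕ) :
    T.neg ^ (n + 1) * T.pos ≤ T.pos * T.neg ^ (n + 1) ⊔ T.base * T.neg ^ n := by
  have := T.op.neg_mul_pos_pow_succ_le n
  simp only [TriangularData.op, ← Submodule.map_op_pow, ← Submodule.map_op_mul,
    ← Submodule.map_sup] at this
  exact (Submodule.map_le_map_iff_of_injective (opLinearEquiv K).injective _ _).mp this

theorem smul_eq_zero_of_mem_neg_pow {n k : ℕ} (hnk : n ≤ k) {m : M}
    (hm : ∀ b ∈ T.neg ^ n, b • m = 0) {b : A} (hb : b ∈ T.neg ^ k) : b • m = 0 := by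
  obtain ⟨j, rfl⟩ := Nat.exists_eq_add_of_le' hnk
  exact smul_eq_zero_of_mem_mul hm (pow_add T.neg j n ▸ hb)

variable [Module K M] [IsScalarTower K A M]

theorem isLocallyNilpotentOn_of_span_eq_top {V : Set M}
    (hV : ∀ v ∈ V, ∃ n, ∀ b ∈ T.neg ^ n, b • v = 0) (span_eq : Submodule.span A V = ⊤) :
    IsLocallyNilpotentOn T.neg M := by
  let N : Submodule K M :=
    { carrier := {m | ∃ n, ∀ b ∈ T.neg ^ n, b • m = 0}
      zero_mem' := ⟨0, fun b _ => smul_zero b⟩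
      add_mem' := by
        rintro m m' ⟨n, hm⟩ ⟨n', hm'⟩
        refine ⟨max n n', fun b hb => ?_⟩
        rw [smul_add, T.smul_eq_zero_of_mem_neg_pow (le_max_left n n') hm hb,
          T.smul_eq_zero_of_mem_neg_pow (le_max_right n n') hm' hb, add_zero]
      smul_mem' := fun z m ⟨n, hm⟩ =>
        ⟨n, fun b hb => by rw [smul_comm b z m, hm b hb, smul_zero]⟩ }
  have pos_smul : T.pos • N ≤ N := Submodule.smul_le.mpr fun x hx m ⟨n, hm⟩ =>
    ⟨n + 1, fun b hb => by
      obtain ⟨u, hu, v, hv, huv⟩ := Submodule.mem_sup.mp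
        (T.neg_pow_succ_mul_pos_le n (Submodule.mul_mem_mul hb hx))
      have kill_succ := fun b hb => T.smul_eq_zero_of_mem_neg_pow (b := b) n.le_succ hm hb
      rw [← mul_smul, ← huv, add_smul, smul_eq_zero_of_mem_mul kill_succ hu,
        smul_eq_zero_of_mem_mul hm hv, add_zero]⟩
  have neg_smul : T.neg • N ≤ N := Submodule.smul_le.mpr fun y hy m ⟨n, hm⟩ =>
    ⟨n, fun b hb => by
      rw [← mul_smul]
      exact T.smul_eq_zero_of_mem_neg_pow n.le_succ hm (Submodule.mul_mem_mul hb hy)⟩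
  have base_smul : T.base • N ≤ N := Submodule.smul_le.mpr fun w hw m ⟨n, hm⟩ =>
    ⟨n, fun b hb => by
      rw [← mul_smul]
      exact smul_eq_zero_of_mem_mul hm (T.neg_pow_mul_base_le n (Submodule.mul_mem_mul hb hw))⟩
  intro m
  have hm : m ∈ Submodule.span A V := span_eq ▸ Submodule.mem_top
  induction hm using Submodule.span_induction with
  | mem m hm => exact hV m hm
  | zero => exact N.zero_mem
  | add _ _ _ _ hm hm' => exact N.add_mem hm hm'
  | smul a m _ hm => exact T.smul_mem_of_generators pos_smul neg_smul base_smul a hm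

theorem exists_neg_pow_smul_eq_bot (nilpotent : IsLocallyNilpotentOn T.neg M) {V : Submodule K M}
    (hV : V.FG) : ∃ n, ∀ k ≥ n, T.neg ^ k • V = ⊥ := by
  induction V, hV using Submodule.fg_induction with
  | singleton v =>
    obtain ⟨n, hn⟩ := nilpotent v
    refine ⟨n, fun k hk => (Submodule.eq_bot_iff _).mpr fun m hm => ?_⟩
    induction hm using Submodule.smul_induction_on' with
    | smul b hb m hm =>
      obtain ⟨z, rfl⟩ := Submodule.mem_span_singleton.mp hm
      rw [smul_comm b z v, T.smul_eq_zero_of_mem_neg_pow hk hn hb, smul_zero]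
    | add _ _ _ _ hm hm' => rw [hm, hm', add_zero]
  | sup V V' _ _ hV hV' =>
    obtain ⟨n, hn⟩ := hV
    obtain ⟨n', hn'⟩ := hV'
    refine ⟨max n n', fun k hk => ?_⟩
    rw [Submodule.smul_sup, hn k (le_of_max_le_left hk), hn' k (le_of_max_le_right hk), sup_bot_eq]

theorem finite_adjoin_pos [Module.Finite A M] (nilpotent : IsLocallyNilpotentOn T.neg M) :
    Module.Finite (Algebra.adjoin K (T.pos : Set A)) M := by
  obtain ⟨s, hs⟩ := Module.Finite.fg_top (R := A) (M := M)
  let V := Submodule.span K (s : Set M)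
  have V_fg : V.FG := Submodule.fg_span s.finite_toSet
  obtain ⟨n, eq_bot⟩ := T.exists_neg_pow_smul_eq_bot nilpotent V_fg
  let V' := ⨆ j, T.base • T.neg ^ j • V
  have le_V' (j : ℕ) : T.base • T.neg ^ j • V ≤ V' := le_iSup (fun j => T.base • T.neg ^ j • V) j
  have V'_eq : V' = ⨆ j : Fin n, T.base • T.neg ^ j.1 • V := by
    refine le_antisymm (iSup_le fun j => ?_) (iSup_le fun j => le_V' j)
    rcases lt_or_ge j n with hj | hj
    · exact le_iSup (fun j : Fin n => T.base • T.neg ^ j.1 • V) ⟨j, hj⟩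
    · rw [eq_bot j hj, Submodule.smul_bot]
      exact bot_le
  have V'_fg : V'.FG := V'_eq ▸ Submodule.fg_iSup _ fun j =>
    fg_smul T.base_fg (fg_smul (T.neg_fg.pow j) V_fg)
  have base_smul : T.base • V' ≤ V' := by
    rw [Submodule.smul_iSup]
    refine iSup_le fun j => ?_
    rw [← Submodule.smul_assoc]
    exact (Submodule.smul_mono_left T.base_mul_base_le).trans (le_V' j)
  have neg_smul : T.neg • V' ≤ V' := by
    rw [Submodule.smul_iSup]
    refine iSup_le fun j => ?_
    rw [← Submodule.smul_assoc]
    refine (Submodule.smul_mono_left T.neg_mul_base_le).trans ?_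
    rw [← smul_eq_mul, Submodule.smul_assoc, ← Submodule.smul_assoc T.neg, smul_eq_mul, ← pow_succ']
    exact le_V' (j + 1)
  have V_le : V ≤ V' := fun v hv => le_V' 0 <| by
    rw [pow_zero, Submodule.one_smul, ← one_smul A v]
    exact Submodule.smul_mem_smul T.one_mem_base hv
  have span_eq : Submodule.span A (V' : Set M) = ⊤ :=
    top_le_iff.mp (hs.ge.trans (Submodule.span_mono (Submodule.subset_span.trans V_le)))
  exact finite_adjoin_iff_exists_iSup_pow_smul_eq_top.mpr
    ⟨V', V'_fg, T.iSup_pos_pow_smul_eq_top base_smul neg_smul span_eq⟩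

end LocallyNilpotentModules

section Annihilators

variable {K A : Type*} [Field K] [Ring A] [Algebra K A] (T : TriangularData K A)

theorem isLocallyNilpotentOn_quotient {N : Ideal A} {n : ℕ}
    (hN : ∀ b ∈ T.neg ^ n, b ∈ N) : IsLocallyNilpotentOn T.neg (A ⧸ N) := by
  refine T.isLocallyNilpotentOn_of_span_eq_top (V := {N.mkQ 1}) ?_ ?_
  · rintro _ rfl
    refine ⟨n, fun b hb => ?_⟩
    rw [← map_smul, smul_eq_mul, mul_one]
    exact (Submodule.Quotient.mk_eq_zero N).mpr (hN b hb)
  · rw [← Set.image_singleton, ← Submodule.map_span, ← Ideal.span, Ideal.span_singleton_one,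
      Submodule.map_top, N.range_mkQ]

attribute [local instance] TensorProduct.Algebra.module

-- The annihilators of the modules `A ⧸ (I + A neg ^ n)` form a descending chain of two-sided ideals
-- with intersection `I`, and a descending chain of bimodules in `A` is stationary.
theorem exists_annihilator_quotient_eq [CharZero K] (I : Ideal A) [I.IsTwoSided] :
    ∃ n, Module.annihilator A (A ⧸ I ⊔ Ideal.span ((T.neg ^ n : Submodule K A) : Set A)) = I := by
  let N (n : ℕ) : Ideal A := I ⊔ Ideal.span ((T.neg ^ n : Submodule K A) : Set A)
  let Q (n : ℕ) : Ideal A := Module.annihilator A (A ⧸ N n)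
  have N_antitone : Antitone N := antitone_nat_of_succ_le fun n =>
    sup_le_sup le_rfl <| Ideal.span_le.mpr fun b hb => by
      rw [pow_succ'] at hb
      refine (Submodule.mul_le (P := (Ideal.span _).restrictScalars K)).mpr (fun y _ b hb => ?_) hb
      exact Ideal.mul_mem_left _ y (Ideal.subset_span hb)
  have Q_antitone : Antitone Q := fun m n h =>
    (Submodule.factor (N_antitone h)).annihilator_le_of_surjective
      (Submodule.factor_surjective (N_antitone h))
  have Q_le (n : ℕ) : Q n ≤ N n := fun a ha => by
    have := Module.mem_annihilator.mp ha ((N n).mkQ 1)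
    rw [← map_smul, smul_eq_mul, mul_one] at this
    exact (Submodule.Quotient.mk_eq_zero _).mp this
  have le_Q (n : ℕ) : I ≤ Q n := fun a ha => Module.mem_annihilator.mpr fun m => by
    obtain ⟨m, rfl⟩ := (N n).mkQ_surjective m
    exact (Submodule.Quotient.mk_eq_zero _).mpr (le_sup_left (a := I) (I.mul_mem_right m ha))
  have : IsArtinian (A ⊗[K] Aᵐᵒᵖ) A :=
    (isFiniteLength_iff_isNoetherian_isArtinian.mp T.isFiniteLength_bimodule).2
  obtain ⟨n, hn⟩ := IsArtinian.monotone_stabilizes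
    (⟨fun n => .toDual (bimoduleOfIdeal K (Q n)), fun _ _ h => Q_antitone h⟩ :
      ℕ →o (Submodule (A ⊗[K] Aᵐᵒᵖ) A)ᵒᵈ)
  refine ⟨n, le_antisymm (fun a ha => ?_) (le_Q n)⟩
  rw [← T.iInf_sup_span_neg_pow I, Submodule.mem_iInf]
  refine fun m => Q_le m ?_
  rcases le_total m n with h | h
  · exact Q_antitone h ha
  · have : bimoduleOfIdeal K (Q n) = bimoduleOfIdeal K (Q m) := hn m h
    exact this.le ha

end Annihilators

theorem exists_isSimpleModule_annihilator_eq {K : Type*} {A : Type u} [Field K] [CharZero K]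
    [Ring A] [Algebra K A] (T : TriangularData K A) {I : Ideal A} (hI : IsPrimeTwoSidedIdeal I) :
    ∃ (L : Type u) (_ : AddCommGroup L) (_ : Module A L), IsSimpleModule A L ∧
      IsLocallyNilpotentOn T.neg L ∧ Module.annihilator A L = I := by
  have := hI.1
  obtain ⟨n, annihilator_eq⟩ := T.exists_annihilator_quotient_eq I
  have nilpotent := T.isLocallyNilpotentOn_quotient
    (N := I ⊔ Ideal.span ((T.neg ^ n : Submodule K A) : Set A))
    fun b hb => le_sup_right (a := I) (Ideal.subset_span hb)
  have := T.finite_adjoin_pos nilpotent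
  obtain ⟨L, _, _, simple, nil, le, le_I⟩ :=
    exists_isSimpleModule_annihilator_le hI T.isFiniteLength nilpotent annihilator_eq.le
  exact ⟨L, _, _, simple, nil, le_antisymm le_I (annihilator_eq.ge.trans le)⟩

section HighestWeight

variable {K A M : Type*} [Field K] [CharZero K] [Ring A] [Algebra K A] (T : TriangularData K A)
  [AddCommGroup M] [Module K M] [Module A M] [IsScalarTower K A M]

theorem codisjoint_spectralComplement {V : Submodule K M} {z : K} (hbase : T.base • V ≤ V)
    (hneg : T.neg • V = ⊥) (heuler : ∀ v ∈ V, T.euler • v = z • v)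
    (span_eq : Submodule.span A (V : Set M) = ⊤) :
    Codisjoint V (spectralComplement (Algebra.lsmul K K M T.euler) z) := by
  rw [codisjoint_iff_le_sup, ← T.iSup_pos_pow_smul_eq_top hbase (hneg.trans_le bot_le) span_eq]
  refine iSup_le fun n => ?_
  rcases n.eq_zero_or_pos with rfl | hn
  · rw [pow_zero, Submodule.one_smul]
    exact le_sup_left
  refine Submodule.smul_le.mpr fun x hx v hv => Submodule.mem_sup_right ?_
  refine mem_spectralComplement_of_apply_eq_smul (μ := z + n) (by simpa using hn.ne') ?_
  rw [Algebra.lsmul_apply, T.euler_smul_smul hx, heuler v hv, smul_comm x z v, add_smul]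

theorem restrictScalars_le_spectralComplement {V : Submodule K M} {z : K}
    (hbase : T.base • V ≤ V) (hneg : T.neg • V = ⊥) (heuler : ∀ v ∈ V, T.euler • v = z • v)
    (span_eq : Submodule.span A (V : Set M) = ⊤) {N : Submodule A M}
    (hN : Disjoint V (N.restrictScalars K)) :
    N.restrictScalars K ≤ spectralComplement (Algebra.lsmul K K M T.euler) z := by
  intro m hm
  obtain ⟨v, hv, m', hm', rfl⟩ := Submodule.mem_sup.mp <|
    (T.codisjoint_spectralComplement hbase hneg heuler span_eq).top_le (Submodule.mem_top (x := m))
  have : v ∈ N.restrictScalars K := mem_of_add_mem_of_mem_spectralComplement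
    (fun x hx => N.smul_mem T.euler hx) (heuler v hv) hm' hm
  rwa [Submodule.disjoint_def.mp hN v hv this, zero_add]

-- Proper submodules have no component of weight `z`, hence neither has their sum.
theorem sSup_ne_top [Nontrivial M] {V : Submodule K M} {z : K} (hbase : T.base • V ≤ V)
    (hneg : T.neg • V = ⊥) (heuler : ∀ v ∈ V, T.euler • v = z • v)
    (span_eq : Submodule.span A (V : Set M) = ⊤)
    (irreducible : ∀ N : Submodule A M,
      Disjoint V (N.restrictScalars K) ∨ V ≤ N.restrictScalars K) :
    sSup {N : Submodule A M | N ≠ ⊤} ≠ ⊤ := by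
  intro sSup_eq
  have mem_spectralComplement (m : M) :
      m ∈ spectralComplement (Algebra.lsmul K K M T.euler) z := by
    have hm : m ∈ sSup {N : Submodule A M | N ≠ ⊤} := sSup_eq.ge Submodule.mem_top
    rw [sSup_eq_iSup'] at hm
    induction hm using Submodule.iSup_induction' with
    | mem N m hm =>
      refine T.restrictScalars_le_spectralComplement hbase hneg heuler span_eq
        ((irreducible N).resolve_right fun h => N.2 ?_) hm
      exact top_le_iff.mp (span_eq.ge.trans (Submodule.span_le.mpr h))
    | zero => exact zero_mem _
    | add _ _ _ _ hm hm' => exact add_mem hm hm'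
  have V_eq : V = ⊥ := (Submodule.eq_bot_iff V).mpr fun v hv =>
    mem_of_add_mem_of_mem_spectralComplement (m := -v) (N := ⊥)
      (fun x hx => by rw [(Submodule.mem_bot K).mp hx, map_zero]; exact zero_mem _)
      (heuler v hv) (mem_spectralComplement _) (by simp)
  exact bot_ne_top (α := Submodule A M) (by rw [← span_eq, V_eq]; simp)

end HighestWeight

end TriangularData

section IrreducibleSubrepresentation

open scoped MonoidAlgebra

variable {k G V : Type*} [Field k] [Group G] [AddCommGroup V] [Module k V]
  {ρ : Representation k G V}

theorem isIrreducible_toRepresentation_of_isAtom {U : Subrepresentation ρ} (hU : IsAtom U) :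
    U.toRepresentation.IsIrreducible := by
  let map (N : Subrepresentation U.toRepresentation) : Subrepresentation ρ :=
    { toSubmodule := N.toSubmodule.map U.toSubmodule.subtype
      apply_mem_toSubmodule := by
        rintro g _ ⟨v, hv, rfl⟩
        exact ⟨_, N.apply_mem_toSubmodule g hv, rfl⟩ }
  have map_injective : Function.Injective map := fun N N' h =>
    Subrepresentation.toSubmodule_injective <|
      Submodule.map_injective_of_injective U.toSubmodule.injective_subtype
        (congrArg Subrepresentation.toSubmodule h)
  have map_bot : map ⊥ = ⊥ := Subrepresentation.toSubmodule_injective (Submodule.map_bot _)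
  have map_top : map ⊤ = U :=
    Subrepresentation.toSubmodule_injective (Submodule.map_subtype_top _)
  exact {
    exists_pair_ne := ⟨⊥, ⊤, fun h => hU.1 (by rw [← map_top, ← h, map_bot])⟩
    eq_bot_or_eq_top := fun N =>
      (hU.le_iff.mp (Submodule.map_subtype_le U.toSubmodule N.toSubmodule : map N ≤ U)).imp
        (fun h => map_injective (h.trans map_bot.symm))
        (fun h => map_injective (h.trans map_top.symm)) }

theorem exists_isIrreducible_le [Finite G] [NeZero (Nat.card G : k)] {U : Subrepresentation ρ}
    (hU : U ≠ ⊥) : ∃ U' ≤ U, U' ≠ ⊥ ∧ U'.toRepresentation.IsIrreducible := by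
  have : IsAtomic (Subrepresentation ρ) :=
    Subrepresentation.subrepresentationSubmoduleOrderIso.isAtomic_iff.mpr inferInstance
  obtain ⟨U', atom, le⟩ := (eq_bot_or_exists_atom_le U).resolve_left hU
  exact ⟨U', le, atom.1, isIrreducible_toRepresentation_of_isAtom atom⟩

theorem finiteDimensional_of_isIrreducible [Finite G] (ρ : Representation k G V)
    [ρ.IsIrreducible] : FiniteDimensional k V := by
  have : Nontrivial ρ.asModule := IsSimpleModule.nontrivial k[G] ρ.asModule
  obtain ⟨v, hv⟩ := exists_ne (0 : ρ.asModule)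
  exact Module.Finite.of_surjective (LinearMap.applyₗ v ∘ₗ ρ.asAlgebraHom.toLinearMap)
    (IsSimpleModule.toSpanSingleton_surjective k[G] hv)

theorem exists_forall_apply_eq_smul [IsAlgClosed k] [FiniteDimensional k V]
    [ρ.IsIrreducible] (f : Module.End k V) (hf : ∀ g, Commute f (ρ g)) :
    ∃ z : k, ∀ v, f v = z • v := by
  let F : Representation.IntertwiningMap ρ ρ := ⟨f, hf⟩
  obtain ⟨z, hz⟩ :=
    (Representation.IsIrreducible.algebraMap_intertwiningMap_bijective_of_isAlgClosed (ρ := ρ)).2 F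
  exact ⟨z, fun v => congrArg (fun f => f.toLinearMap v) hz.symm⟩

end IrreducibleSubrepresentation

namespace Cherednik

section Generators

variable {E : Type u} [NormedAddCommGroup E] [InnerProductSpace ℝ E]
  (W : Subgroup (E ≃ₗᵢ[ℝ] E)) (a : Refl W → E) (c : Refl W → ℂ)

/-- The map `ofY` as a linear map. -/
noncomputable def ofYₗ : 𝔥 E →ₗ[ℂ] H W a c where
  toFun := ofY W a c
  map_add' y y' := (RingQuot.mkAlgHom_rel ℂ (Rel.y_add y y')).trans (map_add _ _ _)
  map_smul' z y := (RingQuot.mkAlgHom_rel ℂ (Rel.y_smul z y)).trans (map_smul _ _ _)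

/-- The map `ofX` as a linear map. -/
noncomputable def ofXₗ : 𝔥Dual E →ₗ[ℂ] H W a c where
  toFun := ofX W a c
  map_add' x x' := (RingQuot.mkAlgHom_rel ℂ (Rel.x_add x x')).trans (map_add _ _ _)
  map_smul' z x := (RingQuot.mkAlgHom_rel ℂ (Rel.x_smul z x)).trans (map_smul _ _ _)

/-- The map `ofW` as a monoid homomorphism. -/
noncomputable def ofWHom : W →* H W a c where
  toFun := ofW W a c
  map_one' := (RingQuot.mkAlgHom_rel ℂ Rel.w_one).trans (map_one _)
  map_mul' w w' := (RingQuot.mkAlgHom_rel ℂ (Rel.w_mul w w')).trans (map_mul _ _ _)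

/-- The image of the group algebra of `W`. -/
noncomputable def spanW : Submodule ℂ (H W a c) := Submodule.span ℂ (Set.range (ofWHom W a c))

variable {W a c}

theorem mk_eq_of_rel {p q : FreeAlgebra ℂ (Gen W)} (h : Rel W a c p q) :
    mk W a c p = mk W a c q :=
  RingQuot.mkAlgHom_rel ℂ h

theorem commute_ofXₗ (x x' : 𝔥Dual E) : Commute (ofXₗ W a c x) (ofXₗ W a c x') := by
  have := mk_eq_of_rel (a := a) (c := c) (.x_comm x x')
  rwa [map_mul, map_mul] at this

theorem commute_ofYₗ (y y' : 𝔥 E) : Commute (ofYₗ W a c y) (ofYₗ W a c y') := by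
  have := mk_eq_of_rel (a := a) (c := c) (.y_comm y y')
  rwa [map_mul, map_mul] at this

theorem ofWHom_mul_ofXₗ (w : W) (x : 𝔥Dual E) :
    ofWHom W a c w * ofXₗ W a c x = ofXₗ W a c (actDual w.1 x) * ofWHom W a c w := by
  have conj : ofWHom W a c w * ofXₗ W a c x * ofWHom W a c w⁻¹ = ofXₗ W a c (actDual w.1 x) := by
    have := mk_eq_of_rel (a := a) (c := c) (.w_x w x)
    rwa [map_mul, map_mul] at this
  rw [← conj, mul_assoc _ (ofWHom W a c w⁻¹), ← map_mul, inv_mul_cancel, map_one, mul_one]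

theorem ofYₗ_mul_ofWHom (w : W) (y : 𝔥 E) :
    ofYₗ W a c y * ofWHom W a c w = ofWHom W a c w * ofYₗ W a c (act (w⁻¹ : W).1 y) := by
  have conj : ofWHom W a c w⁻¹ * ofYₗ W a c y * ofWHom W a c w⁻¹⁻¹ =
      ofYₗ W a c (act (w⁻¹ : W).1 y) := by
    have := mk_eq_of_rel (a := a) (c := c) (.w_y w⁻¹ y)
    rwa [map_mul, map_mul] at this
  rw [← conj, inv_inv, ← mul_assoc, ← mul_assoc, ← map_mul, mul_inv_cancel, map_one, one_mul]

theorem ofYₗ_lie_ofXₗ [Fintype (Refl W)] (y : 𝔥 E) (x : 𝔥Dual E) :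
    ⁅ofYₗ W a c y, ofXₗ W a c x⁆ = x y • 1 +
      ∑ s : Refl W, (c s * root (a s) y * x (coroot (a s))) • ofWHom W a c s.1 := by
  have := mk_eq_of_rel (a := a) (c := c) (.y_x y x)
  rwa [finsum_eq_sum_of_fintype, map_sub, map_mul, map_mul, map_add, map_sum, AlgHom.commutes,
    Algebra.algebraMap_eq_smul_one, Finset.sum_congr rfl fun s _ => map_smul (mk W a c) _ _] at this

theorem eq_top_of_generators {S : Subalgebra ℂ (H W a c)} (hY : ∀ y, ofYₗ W a c y ∈ S)
    (hX : ∀ x, ofXₗ W a c x ∈ S) (hW : ∀ w, ofWHom W a c w ∈ S) : S = ⊤ := by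
  have : S.comap (mk W a c) = ⊤ := by
    rw [← top_le_iff, ← FreeAlgebra.adjoin_range_ι, Algebra.adjoin_le_iff]
    rintro _ ⟨y | x | w, rfl⟩
    exacts [hY y, hX x, hW w]
  refine Algebra.eq_top_iff.mpr fun h => ?_
  obtain ⟨p, rfl⟩ := RingQuot.mkAlgHom_surjective ℂ (Rel W a c) h
  exact (this ▸ Algebra.mem_top : p ∈ S.comap (mk W a c))

theorem ofWHom_mem_spanW (w : W) : ofWHom W a c w ∈ spanW W a c :=
  Submodule.subset_span ⟨w, rfl⟩

theorem spanW_mul_spanW_le : spanW W a c * spanW W a c ≤ spanW W a c := by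
  rw [spanW, Submodule.span_mul_span]
  refine Submodule.span_mono (Set.mul_subset_iff.mpr ?_)
  rintro _ ⟨w, rfl⟩ _ ⟨w', rfl⟩
  exact ⟨w * w', map_mul _ w w'⟩

theorem ofYₗ_lie_ofXₗ_mem_spanW [Finite (Refl W)] (y : 𝔥 E) (x : 𝔥Dual E) :
    ⁅ofYₗ W a c y, ofXₗ W a c x⁆ ∈ spanW W a c := by
  have := Fintype.ofFinite (Refl W)
  rw [ofYₗ_lie_ofXₗ, ← map_one (ofWHom W a c)]
  exact add_mem (Submodule.smul_mem _ _ (ofWHom_mem_spanW 1))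
    (sum_mem fun s _ => Submodule.smul_mem _ _ (ofWHom_mem_spanW s.1))

theorem spanW_mul_le {P Q : Submodule ℂ (H W a c)} (h : ∀ w, ∀ p ∈ P, ofWHom W a c w * p ∈ Q) :
    spanW W a c * P ≤ Q :=
  Submodule.mul_le.mpr fun _ hb p hp =>
    (Submodule.span_le (p := Q.comap (LinearMap.mulRight ℂ p))).mpr
      (Set.range_subset_iff.mpr fun w => h w p hp) hb

theorem mul_spanW_le {P Q : Submodule ℂ (H W a c)} (h : ∀ p ∈ P, ∀ w, p * ofWHom W a c w ∈ Q) :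
    P * spanW W a c ≤ Q :=
  Submodule.mul_le.mpr fun p hp _ hb =>
    (Submodule.span_le (p := Q.comap (LinearMap.mulLeft ℂ p))).mpr
      (Set.range_subset_iff.mpr fun w => h p hp w) hb

end Generators

section Reflections

variable {E : Type u} [NormedAddCommGroup E] [InnerProductSpace ℝ E]
  {W : Subgroup (E ≃ₗᵢ[ℝ] E)} {a : Refl W → E}

theorem act_refl (ha : IsRootChoice W a) (s : Refl W) (y : 𝔥 E) :
    act s.1.1 y = y - root (a s) y • coroot (a s) := by
  induction y using TensorProduct.induction_on with
  | zero => simp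
  | tmul z e =>
    have reflection_apply :
        s.1.1 e = e - (2 * inner ℝ (a s) e / inner ℝ (a s) (a s)) • a s := by
      rw [(ha s).2, Submodule.reflection_orthogonal_apply, Submodule.reflection_singleton_apply,
        real_inner_self_eq_norm_sq, neg_sub, ← Nat.cast_smul_eq_nsmul ℝ, smul_smul]
      simp [mul_div_assoc]
    rw [root, Module.Dual.baseChange_apply_tmul, innerₛₗ_apply_apply, coroot,
      TensorProduct.smul_tmul', smul_eq_mul, mul_one, ← TensorProduct.smul_tmul',
      ← TensorProduct.tmul_smul, smul_smul, ← TensorProduct.tmul_sub]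
    change z ⊗ₜ[ℝ] s.1.1 e = _
    rw [reflection_apply]
    congr 3
    ring
  | add y y' hy hy' => rw [map_add, hy, hy', map_add, add_smul]; abel

theorem refl_inv (ha : IsRootChoice W a) (s : Refl W) : s.1⁻¹ = s.1 :=
  Subtype.ext <| by rw [Subgroup.coe_inv, (ha s).2, Submodule.reflection_inv]

theorem actDual_refl (ha : IsRootChoice W a) (s : Refl W) (x : 𝔥Dual E) :
    actDual s.1.1 x = x - x (coroot (a s)) • root (a s) := by
  refine LinearMap.ext fun y => ?_
  rw [actDual, ← Subgroup.coe_inv, refl_inv ha, LinearMap.comp_apply, act_refl ha, map_sub,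
    map_smul, LinearMap.sub_apply, LinearMap.smul_apply, smul_eq_mul, smul_eq_mul, mul_comm]

end Reflections

section EulerGroupPart

variable {E : Type u} [NormedAddCommGroup E] [InnerProductSpace ℝ E]
  {W : Subgroup (E ≃ₗᵢ[ℝ] E)} {a : Refl W → E} {c : Refl W → ℂ}

variable (W a c) in
/-- The part `∑ c_s s` of the Euler element. -/
noncomputable def eulerW : H W a c := ∑ᶠ s : Refl W, c s • ofWHom W a c s.1

theorem eulerW_mem_spanW [Finite (Refl W)] : eulerW W a c ∈ spanW W a c := by
  have := Fintype.ofFinite (Refl W)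
  rw [eulerW, finsum_eq_sum_of_fintype]
  exact sum_mem fun s _ => Submodule.smul_mem _ _ (ofWHom_mem_spanW s.1)

variable [Fintype (Refl W)]

theorem eulerW_lie_ofXₗ (ha : IsRootChoice W a) (x : 𝔥Dual E) :
    ⁅eulerW W a c, ofXₗ W a c x⁆ =
      -∑ s : Refl W, (c s * x (coroot (a s))) • (ofXₗ W a c (root (a s)) * ofWHom W a c s.1) := by
  rw [eulerW, finsum_eq_sum_of_fintype, sum_lie, ← Finset.sum_neg_distrib]
  refine Finset.sum_congr rfl fun s _ => ?_
  rw [Ring.lie_def, smul_mul_assoc, ofWHom_mul_ofXₗ, actDual_refl ha, map_sub, map_smul, sub_mul,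
    smul_sub, mul_smul_comm, smul_mul_assoc, smul_smul, sub_sub_cancel_left]

theorem eulerW_lie_ofYₗ (ha : IsRootChoice W a) (y : 𝔥 E) :
    ⁅eulerW W a c, ofYₗ W a c y⁆ =
      ∑ s : Refl W, (c s * root (a s) y) • (ofWHom W a c s.1 * ofYₗ W a c (coroot (a s))) := by
  rw [eulerW, finsum_eq_sum_of_fintype, sum_lie]
  refine Finset.sum_congr rfl fun s _ => ?_
  rw [Ring.lie_def, mul_smul_comm, ofYₗ_mul_ofWHom, refl_inv ha, act_refl ha, map_sub, map_smul,
    mul_sub, smul_sub, smul_mul_assoc, mul_smul_comm, smul_smul, sub_sub_cancel]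

end EulerGroupPart

section EulerPolynomialPart

variable {E : Type u} [NormedAddCommGroup E] [InnerProductSpace ℝ E] [FiniteDimensional ℝ E]
  {W : Subgroup (E ≃ₗᵢ[ℝ] E)} {a : Refl W → E} {c : Refl W → ℂ}

variable (E) in
/-- A basis of `𝔥`, in which the Euler element is expressed. -/
noncomputable def basisY : Module.Basis (Fin (Module.finrank ℝ E)) ℂ (𝔥 E) :=
  Algebra.TensorProduct.basis ℂ (Module.finBasis ℝ E)

variable (E) in
/-- The basis of `𝔥*` dual to `basisY`. -/
noncomputable def basisX : Module.Basis (Fin (Module.finrank ℝ E)) ℂ (𝔥Dual E) :=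
  (basisY E).dualBasis

theorem sum_basisX_smul_basisY (y : 𝔥 E) : ∑ i, basisX E i y • basisY E i = y := by
  simp [basisX, (basisY E).sum_repr y]

theorem sum_smul_basisX (x : 𝔥Dual E) : ∑ i, x (basisY E i) • basisX E i = x :=
  (basisY E).ext fun j => by simp [basisX]

variable (W a c) in
/-- The part `∑ xᵢ yᵢ` of the Euler element, for dual bases `yᵢ` of `𝔥` and `xᵢ` of `𝔥*`. -/
noncomputable def eulerXY : H W a c := ∑ i, ofXₗ W a c (basisX E i) * ofYₗ W a c (basisY E i)

variable [Fintype (Refl W)]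

theorem eulerXY_lie_ofXₗ (x : 𝔥Dual E) :
    ⁅eulerXY W a c, ofXₗ W a c x⁆ = ofXₗ W a c x +
      ∑ s : Refl W, (c s * x (coroot (a s))) • (ofXₗ W a c (root (a s)) * ofWHom W a c s.1) := by
  have lie_summand (i) : ⁅ofXₗ W a c (basisX E i) * ofYₗ W a c (basisY E i), ofXₗ W a c x⁆ =
      ofXₗ W a c (x (basisY E i) • basisX E i) + ∑ s : Refl W, (c s * x (coroot (a s))) •
        (ofXₗ W a c (root (a s) (basisY E i) • basisX E i) * ofWHom W a c s.1) := by
    have : ⁅ofXₗ W a c (basisX E i) * ofYₗ W a c (basisY E i), ofXₗ W a c x⁆ =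
        ofXₗ W a c (basisX E i) * ⁅ofYₗ W a c (basisY E i), ofXₗ W a c x⁆ := by
      rw [Ring.lie_def, Ring.lie_def, mul_sub, ← mul_assoc _ (ofXₗ W a c x),
        (commute_ofXₗ (basisX E i) x).eq, mul_assoc, mul_assoc]
    rw [this, ofYₗ_lie_ofXₗ, mul_add, mul_smul_comm, mul_one, ← map_smul, Finset.mul_sum]
    refine congrArg _ (Finset.sum_congr rfl fun s _ => ?_)
    rw [mul_smul_comm, map_smul, smul_mul_assoc, smul_smul, mul_right_comm]
  rw [eulerXY, sum_lie, Finset.sum_congr rfl fun i _ => lie_summand i, Finset.sum_add_distrib,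
    ← map_sum, sum_smul_basisX, Finset.sum_comm]
  refine congrArg _ (Finset.sum_congr rfl fun s _ => ?_)
  rw [← Finset.smul_sum, ← Finset.sum_mul, ← map_sum, sum_smul_basisX]

theorem eulerXY_lie_ofYₗ (y : 𝔥 E) :
    ⁅eulerXY W a c, ofYₗ W a c y⁆ = -ofYₗ W a c y -
      ∑ s : Refl W, (c s * root (a s) y) • (ofWHom W a c s.1 * ofYₗ W a c (coroot (a s))) := by
  have lie_summand (i) : ⁅ofXₗ W a c (basisX E i) * ofYₗ W a c (basisY E i), ofYₗ W a c y⁆ =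
      -(ofYₗ W a c (basisX E i y • basisY E i) + ∑ s : Refl W, (c s * root (a s) y) •
        (ofWHom W a c s.1 * ofYₗ W a c (basisX E i (coroot (a s)) • basisY E i))) := by
    have : ⁅ofXₗ W a c (basisX E i) * ofYₗ W a c (basisY E i), ofYₗ W a c y⁆ =
        -(⁅ofYₗ W a c y, ofXₗ W a c (basisX E i)⁆ * ofYₗ W a c (basisY E i)) := by
      rw [Ring.lie_def, Ring.lie_def, sub_mul, mul_assoc _ _ (ofYₗ W a c y),
        (commute_ofYₗ (basisY E i) y).eq, mul_assoc, mul_assoc, neg_sub]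
    rw [this, ofYₗ_lie_ofXₗ, add_mul, smul_mul_assoc, one_mul, ← map_smul, Finset.sum_mul]
    refine congrArg _ (congrArg _ (Finset.sum_congr rfl fun s _ => ?_))
    rw [smul_mul_assoc, map_smul, mul_smul_comm, smul_smul]
  rw [eulerXY, sum_lie, Finset.sum_congr rfl fun i _ => lie_summand i, Finset.sum_neg_distrib,
    Finset.sum_add_distrib, ← map_sum, sum_basisX_smul_basisY, Finset.sum_comm, neg_add']
  refine congrArg _ (Finset.sum_congr rfl fun s _ => ?_)
  rw [← Finset.smul_sum, ← Finset.mul_sum, ← map_sum, sum_basisX_smul_basisY]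

end EulerPolynomialPart

section TriangularStructure

variable {E : Type u} [NormedAddCommGroup E] [InnerProductSpace ℝ E] [FiniteDimensional ℝ E]
  {W : Subgroup (E ≃ₗᵢ[ℝ] E)} {a : Refl W → E} (c : Refl W → ℂ)

/-- The triangular structure of the rational Cherednik algebra given by `𝔥*`, `𝔥`, the group
algebra of `W` and the Euler element. -/
noncomputable def triangularData [Finite W] (ha : IsRootChoice W a) :
    TriangularData ℂ (H W a c) where
  pos := LinearMap.range (ofXₗ W a c)
  neg := LinearMap.range (ofYₗ W a c)
  base := spanW W a c
  euler := eulerXY W a c + eulerW W a c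
  pos_fg := Module.Finite.iff_fg.mp inferInstance
  neg_fg := Module.Finite.iff_fg.mp inferInstance
  base_fg := Submodule.fg_span (Set.finite_range _)
  pos_comm := by
    rintro _ ⟨x, rfl⟩ _ ⟨x', rfl⟩
    exact commute_ofXₗ x x'
  neg_comm := by
    rintro _ ⟨y, rfl⟩ _ ⟨y', rfl⟩
    exact commute_ofYₗ y y'
  one_mem_base := map_one (ofWHom W a c) ▸ ofWHom_mem_spanW 1
  base_mul_base_le := spanW_mul_spanW_le
  base_mul_pos_le := by
    refine spanW_mul_le ?_
    rintro w _ ⟨x, rfl⟩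
    rw [ofWHom_mul_ofXₗ]
    exact Submodule.mul_mem_mul ⟨_, rfl⟩ (ofWHom_mem_spanW w)
  neg_mul_base_le := by
    refine mul_spanW_le ?_
    rintro _ ⟨y, rfl⟩ w
    rw [ofYₗ_mul_ofWHom]
    exact Submodule.mul_mem_mul (ofWHom_mem_spanW w) ⟨_, rfl⟩
  neg_mul_pos_le := by
    rw [Submodule.mul_le]
    rintro _ ⟨y, rfl⟩ _ ⟨x, rfl⟩
    rw [← add_sub_cancel (ofXₗ W a c x * ofYₗ W a c y) (ofYₗ W a c y * ofXₗ W a c x)]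
    exact Submodule.add_mem_sup (Submodule.mul_mem_mul ⟨x, rfl⟩ ⟨y, rfl⟩)
      (ofYₗ_lie_ofXₗ_mem_spanW y x)
  euler_mem := Submodule.add_mem_sup
    (sum_mem fun i _ => Submodule.mul_mem_mul ⟨_, rfl⟩ ⟨_, rfl⟩) (eulerW_mem_spanW)
  euler_lie_pos := by
    have := Fintype.ofFinite (Refl W)
    rintro _ ⟨x, rfl⟩
    rw [add_lie, eulerXY_lie_ofXₗ, eulerW_lie_ofXₗ ha, add_neg_cancel_right]
  euler_lie_neg := by
    have := Fintype.ofFinite (Refl W)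
    rintro _ ⟨y, rfl⟩
    rw [add_lie, eulerXY_lie_ofYₗ, eulerW_lie_ofYₗ ha, sub_add_cancel]
  generates S hpos hneg hbase := eq_top_of_generators (fun y => hneg ⟨y, rfl⟩)
    (fun x => hpos ⟨x, rfl⟩) fun w => hbase (ofWHom_mem_spanW w)

end TriangularStructure

section Conjugation

variable {E : Type u} [NormedAddCommGroup E] [InnerProductSpace ℝ E]
  {W : Subgroup (E ≃ₗᵢ[ℝ] E)} {c : Refl W → ℂ}

theorem mul_reflection_mul_inv (w : E ≃ₗᵢ[ℝ] E) (v : E) :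
    w * (Submodule.span ℝ {v})ᗮ.reflection * w⁻¹ = (Submodule.span ℝ {w v})ᗮ.reflection := by
  have span_orthogonal_eq : (Submodule.span ℝ {w v})ᗮ =
      (Submodule.span ℝ {v})ᗮ.map (w.toLinearEquiv : E →ₗ[ℝ] E) := by
    simp [Submodule.map_orthogonal_equiv, Submodule.map_span]
  simp only [span_orthogonal_eq, Submodule.reflection_map]
  rfl

/-- Conjugation by `w` on the set of reflections. -/
def conjRefl (w : W) (s : Refl W) : Refl W :=
  ⟨w * s.1 * w⁻¹, by
    obtain ⟨v, hv, hs⟩ := s.2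
    exact ⟨w.1 v, by simpa using hv, by rw [← mul_reflection_mul_inv, ← hs]; rfl⟩⟩

/-- Conjugation by `w` as a permutation of the set of reflections. -/
def conjReflEquiv (w : W) : Refl W ≃ Refl W where
  toFun := conjRefl w
  invFun := conjRefl w⁻¹
  left_inv s := Subtype.ext (by simp [conjRefl, mul_assoc])
  right_inv s := Subtype.ext (by simp [conjRefl, mul_assoc])

theorem commute_sum_refl [Fintype (Refl W)] (hc : IsInvariant W c) {B : Type*} [Ring B]
    [Algebra ℂ B] (φ : W →* B) (w : W) : Commute (∑ s : Refl W, c s • φ s.1) (φ w) := by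
  rw [Commute, SemiconjBy, Finset.sum_mul, Finset.mul_sum, ← Equiv.sum_comp (conjReflEquiv w)]
  refine Finset.sum_congr rfl fun s _ => ?_
  have c_conj : c (conjReflEquiv w s) = c s := hc w s _ rfl
  have conj_mul : (conjReflEquiv w s).1 * w = w * s.1 := inv_mul_cancel_right _ _
  rw [c_conj, smul_mul_assoc, mul_smul_comm, ← map_mul, ← map_mul, conj_mul]

end Conjugation

section Singular

variable {E : Type u} [NormedAddCommGroup E] [InnerProductSpace ℝ E]
  (W : Subgroup (E ≃ₗᵢ[ℝ] E)) (a : Refl W → E) (c : Refl W → ℂ)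
  (M : Type*) [AddCommGroup M] [Module ℂ M] [Module (H W a c) M] [IsScalarTower ℂ (H W a c) M]

/-- The representation of `W` on an `H_c`-module. -/
noncomputable def groupRep : Representation ℂ W M :=
  (Algebra.lsmul ℂ ℂ M).toMonoidHom.comp (ofWHom W a c)

/-- The representation of `W` on the singular vectors, i.e. those killed by `𝔥`. -/
noncomputable def singularVectors : Subrepresentation (groupRep W a c M) where
  toSubmodule := ⨅ y : 𝔥 E, LinearMap.ker (Algebra.lsmul ℂ ℂ M (ofYₗ W a c y))
  apply_mem_toSubmodule w m hm := by
    rw [Submodule.mem_iInf] at hm ⊢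
    intro y
    change ofYₗ W a c y • ofWHom W a c w • m = 0
    rw [← mul_smul, ofYₗ_mul_ofWHom, mul_smul]
    exact (congrArg _ (hm _)).trans (smul_zero _)

end Singular

section StandardModule

variable {E : Type u} [NormedAddCommGroup E] [InnerProductSpace ℝ E]
  {W : Subgroup (E ≃ₗᵢ[ℝ] E)} {a : Refl W → E} {c : Refl W → ℂ}
  {V : Type u} [AddCommGroup V] [Module ℂ V] {σ : Representation ℂ W V}
  {M : Type*} [AddCommGroup M] [Module ℂ M] [Module (H W a c) M] [IsScalarTower ℂ (H W a c) M]

namespace Standard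

variable (a c σ) in
/-- The map `v ↦ 1 ⊗ v` from `σ` to its standard module. -/
noncomputable def ι : V →ₗ[ℂ] Standard a c σ :=
  ((standardRel a c σ).mkQ.restrictScalars ℂ) ∘ₗ TensorProduct.mk ℂ (H W a c) V 1

theorem mk_tmul (h : H W a c) (v : V) :
    (standardRel a c σ).mkQ (h ⊗ₜ v) = h • ι a c σ v := by
  change _ = (standardRel a c σ).mkQ (h • (1 ⊗ₜ v))
  rw [TensorProduct.smul_tmul', smul_eq_mul, mul_one]

theorem ofWHom_smul_ι (w : W) (v : V) : ofWHom W a c w • ι a c σ v = ι a c σ (σ w v) := by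
  rw [← mk_tmul]
  exact (Submodule.Quotient.eq _).mpr (Submodule.subset_span (Or.inl ⟨w, v, rfl⟩))

theorem ofYₗ_smul_ι (y : 𝔥 E) (v : V) : ofYₗ W a c y • ι a c σ v = 0 := by
  rw [← mk_tmul]
  exact (Submodule.Quotient.mk_eq_zero _).mpr (Submodule.subset_span (Or.inr ⟨y, v, rfl⟩))

theorem span_range_ι : Submodule.span (H W a c) (Set.range (ι a c σ)) = ⊤ := by
  refine eq_top_iff.mpr fun x _ => ?_
  obtain ⟨t, rfl⟩ := (standardRel a c σ).mkQ_surjective x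
  induction t using TensorProduct.induction_on with
  | zero => exact zero_mem _
  | tmul h v => exact mk_tmul h v ▸ Submodule.smul_mem _ _ (Submodule.subset_span ⟨v, rfl⟩)
  | add t t' ht ht' => exact add_mem (ht Submodule.mem_top) (ht' Submodule.mem_top)

/-- The universal property of the standard module: the extension to it of a `W`-equivariant map
from `σ` to the singular vectors of `M`. -/
noncomputable def lift (f : V →ₗ[ℂ] M) (hW : ∀ w v, ofWHom W a c w • f v = f (σ w v))
    (hY : ∀ y v, ofYₗ W a c y • f v = 0) : Standard a c σ →ₗ[H W a c] M :=
  (standardRel a c σ).liftQ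
    (TensorProduct.AlgebraTensorModule.lift
      (LinearMap.toSpanSingleton (H W a c) (V →ₗ[ℂ] M) f)) <| by
    rw [standardRel, Submodule.span_le]
    rintro _ (⟨w, v, rfl⟩ | ⟨y, v, rfl⟩)
    · simpa [sub_eq_zero] using! hW w v
    · simpa using! hY y v

theorem lift_ι (f : V →ₗ[ℂ] M) (hW : ∀ w v, ofWHom W a c w • f v = f (σ w v))
    (hY : ∀ y v, ofYₗ W a c y • f v = 0) (v : V) : lift f hW hY (ι a c σ v) = f v :=
  one_smul (H W a c) (f v)

end Standard

variable [FiniteDimensional ℝ E] [Finite W] [σ.IsIrreducible]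

theorem Standard.exists_forall_euler_smul_ι (ha : IsRootChoice W a) (hc : IsInvariant W c) :
    ∃ z : ℂ, ∀ v, (triangularData c ha).euler • ι a c σ v = z • ι a c σ v := by
  have := Fintype.ofFinite (Refl W)
  have := finiteDimensional_of_isIrreducible σ
  obtain ⟨z, hz⟩ := exists_forall_apply_eq_smul (ρ := σ) _ (commute_sum_refl hc σ)
  have eulerXY_smul (v) : eulerXY W a c • ι a c σ v = 0 := by
    rw [eulerXY, Finset.sum_smul]
    exact Finset.sum_eq_zero fun i _ => by rw [mul_smul, ofYₗ_smul_ι, smul_zero]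
  have eulerW_smul (v) : eulerW W a c • ι a c σ v = z • ι a c σ v := by
    rw [eulerW, finsum_eq_sum_of_fintype, Finset.sum_smul, ← map_smul, ← hz, LinearMap.sum_apply,
      map_sum]
    exact Finset.sum_congr rfl fun s _ => by
      rw [smul_assoc, ofWHom_smul_ι, LinearMap.smul_apply, map_smul]
  exact ⟨z, fun v => (add_smul _ _ _).trans (by rw [eulerXY_smul, eulerW_smul, zero_add])⟩

theorem Standard.sSup_ne_top (ha : IsRootChoice W a) (hc : IsInvariant W c)
    [Nontrivial (Standard a c σ)] :
    sSup {N : Submodule (H W a c) (Standard a c σ) | N ≠ ⊤} ≠ ⊤ := by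
  obtain ⟨z, hz⟩ := exists_forall_euler_smul_ι (σ := σ) ha hc
  refine (triangularData c ha).sSup_ne_top (V := LinearMap.range (ι a c σ)) (z := z) ?_ ?_
    (by rintro _ ⟨v, rfl⟩; exact hz v) span_range_ι fun N => ?_
  · refine Submodule.smul_le.mpr fun b hb m hm => ?_
    have : spanW W a c ≤ (LinearMap.range (ι a c σ)).comap
        (LinearMap.toSpanSingleton (H W a c) _ m |>.restrictScalars ℂ) := by
      obtain ⟨v, rfl⟩ := hm
      rw [spanW, Submodule.span_le]
      rintro _ ⟨w, rfl⟩
      exact ⟨σ w v, (ofWHom_smul_ι w v).symm⟩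
    exact this hb
  · rw [eq_bot_iff, Submodule.smul_le]
    rintro _ ⟨y, rfl⟩ _ ⟨v, rfl⟩
    exact ofYₗ_smul_ι y v
  · let U : Subrepresentation σ :=
      { toSubmodule := (N.restrictScalars ℂ).comap (ι a c σ)
        apply_mem_toSubmodule := fun w v hv => by
          change ι a c σ (σ w v) ∈ N
          exact ofWHom_smul_ι (a := a) (c := c) w v ▸ N.smul_mem _ hv }
    refine (eq_bot_or_eq_top U).imp (fun U_eq => ?_) fun U_eq => ?_
    · rw [Submodule.disjoint_def]
      rintro _ ⟨v, rfl⟩ hv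
      have : v ∈ (⊥ : Subrepresentation σ) := U_eq.le hv
      rw [(Submodule.mem_bot ℂ).mp this, map_zero]
    · rintro _ ⟨v, rfl⟩
      exact U_eq.ge (Submodule.mem_top : v ∈ (⊤ : Submodule ℂ V))

theorem nonempty_L_equiv (ha : IsRootChoice W a) (hc : IsInvariant W c)
    [IsSimpleModule (H W a c) M] {f : V →ₗ[ℂ] M} (f_ne : f ≠ 0)
    (hW : ∀ w v, ofWHom W a c w • f v = f (σ w v)) (hY : ∀ y v, ofYₗ W a c y • f v = 0) :
    Nonempty (L a c σ ≃ₗ[H W a c] M) := by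
  have lift_ne : Standard.lift f hW hY ≠ 0 := fun h =>
    f_ne (LinearMap.ext fun v => by rw [← Standard.lift_ι f hW hY, h]; rfl)
  have surjective := LinearMap.surjective_of_ne_zero lift_ne
  have : Nontrivial M := IsSimpleModule.nontrivial (H W a c) M
  have : Nontrivial (Standard a c σ) := surjective.nontrivial
  have ker_isCoatom : IsCoatom (LinearMap.ker (Standard.lift f hW hY)) :=
    isSimpleModule_iff_isCoatom.mp
      (IsSimpleModule.congr ((Standard.lift f hW hY).quotKerEquivOfSurjective surjective))
  have sSup_eq := (ker_isCoatom.le_iff_eq (Standard.sSup_ne_top ha hc)).mp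
    (le_sSup ker_isCoatom.1)
  exact ⟨(Submodule.quotEquivOfEq _ _ sSup_eq).trans
    ((Standard.lift f hW hY).quotKerEquivOfSurjective surjective)⟩

end StandardModule

theorem exists_L_equiv {E : Type u} [NormedAddCommGroup E] [InnerProductSpace ℝ E]
    [FiniteDimensional ℝ E] {W : Subgroup (E ≃ₗᵢ[ℝ] E)} [Finite W] {a : Refl W → E}
    (ha : IsRootChoice W a) {c : Refl W → ℂ} (hc : IsInvariant W c) (M : Type u) [AddCommGroup M]
    [Module (H W a c) M] [IsSimpleModule (H W a c) M]
    (nilpotent : IsLocallyNilpotentOn (LinearMap.range (ofYₗ W a c)) M) :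
    ∃ (V : Type u) (_ : AddCommGroup V) (_ : Module ℂ V) (σ : Representation ℂ W V),
      σ.IsIrreducible ∧ Nonempty (L a c σ ≃ₗ[H W a c] M) := by
  let _ : Module ℂ M := Module.compHom M (algebraMap ℂ (H W a c))
  have : IsScalarTower ℂ (H W a c) M :=
    ⟨fun z h m => by rw [Algebra.smul_def, mul_smul]; rfl⟩
  have : Nontrivial M := IsSimpleModule.nontrivial (H W a c) M
  obtain ⟨m, m_ne, hm⟩ := nilpotent.exists_ne_zero_forall_smul_eq_zero
  have singularVectors_ne : singularVectors W a c M ≠ ⊥ := fun h =>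
    m_ne <| h.le <| (Submodule.mem_iInf _).mpr fun y => hm _ ⟨y, rfl⟩
  obtain ⟨U, U_le, U_ne, irreducible⟩ := exists_isIrreducible_le singularVectors_ne
  refine ⟨U.toSubmodule, inferInstance, inferInstance, U.toRepresentation, irreducible,
    nonempty_L_equiv ha hc (f := U.toSubmodule.subtype) (fun subtype_eq => U_ne ?_)
      (fun _ _ => rfl) fun y v => (Submodule.mem_iInf _).mp (U_le v.2) y⟩
  rw [← LinearMap.range_eq_bot, Submodule.range_subtype] at subtype_eq
  exact Subrepresentation.toSubmodule_injective subtype_eq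

end Cherednik

section RightModules

variable {A : Type u} [Ring A] {I : Ideal A} {M : Type*} [AddCommGroup M] [Module Aᵐᵒᵖ M]

theorem oppositeIdeal_eq_annihilator_iff [I.IsTwoSided] :
    oppositeIdeal I = Module.annihilator Aᵐᵒᵖ M ↔ ∀ r, r ∈ I ↔ ∀ m : M, op r • m = 0 := by
  simp only [SetLike.ext_iff, Module.mem_annihilator]
  exact ⟨fun h r => h (op r), fun h x => h x.unop⟩

end RightModules

namespace Cherednik

section CategoryO

variable {E : Type u} [NormedAddCommGroup E] [InnerProductSpace ℝ E] [FiniteDimensional ℝ E]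
  {W : Subgroup (E ≃ₗᵢ[ℝ] E)} [Finite W] {a : Refl W → E} {c : Refl W → ℂ} {I : Ideal (H W a c)}

theorem exists_inOUp_annihilator_eq (ha : IsRootChoice W a) (hI : IsPrimeTwoSidedIdeal I) :
    ∃ (M : Type u) (_ : AddCommGroup M) (_ : Module (H W a c) M),
      InOUp W a c M ∧ IsSimpleModule (H W a c) M ∧ I = Module.annihilator (H W a c) M := by
  obtain ⟨M, _, _, simple, nilpotent, rfl⟩ :=
    (triangularData c ha).exists_isSimpleModule_annihilator_eq hI
  exact ⟨M, _, _, ⟨inferInstance, nilpotent.leftLocallyNilpotent fun _ h => h.1⟩, simple, rfl⟩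

theorem exists_inODown_forall_mem_iff (ha : IsRootChoice W a) (hI : IsPrimeTwoSidedIdeal I) :
    ∃ (M : Type u) (_ : AddCommGroup M) (_ : Module (H W a c)ᵐᵒᵖ M),
      InODown W a c M ∧ IsSimpleModule (H W a c)ᵐᵒᵖ M ∧ ∀ r, r ∈ I ↔ ∀ m : M, op r • m = 0 := by
  have := hI.1
  obtain ⟨M, _, _, simple, nilpotent, annihilator_eq⟩ :=
    (triangularData c ha).op.exists_isSimpleModule_annihilator_eq
      ((isPrimeTwoSidedIdeal_oppositeIdeal hI.2.1).mpr hI)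
  exact ⟨M, _, _, ⟨inferInstance, IsLocallyNilpotentOn.rightLocallyNilpotent nilpotent
    fun _ h => h.1⟩, simple, oppositeIdeal_eq_annihilator_iff.mp annihilator_eq.symm⟩

theorem exists_annihilator_L_eq (ha : IsRootChoice W a) (hc : IsInvariant W c)
    (hI : IsPrimeTwoSidedIdeal I) :
    ∃ (V : Type u) (_ : AddCommGroup V) (_ : Module ℂ V) (σ : Representation ℂ W V),
      σ.IsIrreducible ∧ IsSimpleModule (H W a c) (L a c σ) ∧
        I = Module.annihilator (H W a c) (L a c σ) := by
  obtain ⟨M, _, _, _, nilpotent, rfl⟩ :=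
    (triangularData c ha).exists_isSimpleModule_annihilator_eq hI
  obtain ⟨V, _, _, σ, irreducible, ⟨e⟩⟩ := exists_L_equiv ha hc M nilpotent
  exact ⟨V, _, _, σ, irreducible, IsSimpleModule.congr e, e.annihilator_eq.symm⟩

end CategoryO

end Cherednik

theorem mainTheorem9_general {E : Type u} [NormedAddCommGroup E] [InnerProductSpace ℝ E]
    [FiniteDimensional ℝ E] (W : Subgroup (E ≃ₗᵢ[ℝ] E)) [Finite W]
    (a : Cherednik.Refl W → E) (ha : Cherednik.IsRootChoice W a)
    (c : Cherednik.Refl W → ℂ) (hc : Cherednik.IsInvariant W c) :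
    (∀ I : Ideal (Cherednik.H W a c), I.IsTwoSided → I ≠ ⊤ →
      List.TFAE [
        IsPrimitiveIdeal I,
        IsPrimeTwoSidedIdeal I,
        ∃ (M : Type u) (_ : AddCommGroup M) (_ : Module (Cherednik.H W a c) M),
          Cherednik.InOUp W a c M ∧ IsSimpleModule (Cherednik.H W a c) M ∧
            I = Module.annihilator (Cherednik.H W a c) M,
        ∃ (M : Type u) (_ : AddCommGroup M) (_ : Module (Cherednik.H W a c)ᵐᵒᵖ M),
          Cherednik.InODown W a c M ∧ IsSimpleModule (Cherednik.H W a c)ᵐᵒᵖ M ∧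
            ∀ r : Cherednik.H W a c, r ∈ I ↔ ∀ m : M, MulOpposite.op r • m = 0]) ∧
    (∀ I : Ideal (Cherednik.H W a c), IsPrimitiveIdeal I →
      ∃ (V : Type u) (_ : AddCommGroup V) (_ : Module ℂ V) (σ : Representation ℂ W V),
        σ.IsIrreducible ∧ IsSimpleModule (Cherednik.H W a c) (Cherednik.L a c σ) ∧
          I = Module.annihilator (Cherednik.H W a c) (Cherednik.L a c σ)) ∧
    {I : Ideal (Cherednik.H W a c) | IsPrimitiveIdeal I}.Finite ∧
    HasFiniteLengthAsBimodule (Cherednik.H W a c) := by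
  have finite_length := (Cherednik.triangularData c ha).isFiniteLength_bimodule
  refine ⟨fun I hI ne_top => ?_,
    fun I hI => Cherednik.exists_annihilator_L_eq ha hc hI.isPrimeTwoSidedIdeal,
    (finite_setOf_isPrimeTwoSidedIdeal finite_length).subset fun I hI => hI.isPrimeTwoSidedIdeal,
    finite_length⟩
  tfae_have 1 → 2 := IsPrimitiveIdeal.isPrimeTwoSidedIdeal
  tfae_have 2 → 3 := Cherednik.exists_inOUp_annihilator_eq ha
  tfae_have 3 → 1 := fun ⟨M, _, _, _, simple, eq⟩ => ⟨M, _, _, simple, eq⟩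
  tfae_have 2 → 4 := Cherednik.exists_inODown_forall_mem_iff ha
  tfae_have 4 → 2 := by
    rintro ⟨M, _, _, -, simple, mem_iff⟩
    rw [← isPrimeTwoSidedIdeal_oppositeIdeal ne_top,
      oppositeIdeal_eq_annihilator_iff.mpr mem_iff]
    exact isPrimeTwoSidedIdeal_annihilator M
  tfae_finish

theorem mainTheorem9 {E : Type u} [NormedAddCommGroup E] [InnerProductSpace ℝ E]
    [FiniteDimensional ℝ E] (W : Subgroup (E ≃ₗᵢ[ℝ] E))
    (hW : Cherednik.IsFiniteCoxeterGroup W)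
    (a : Cherednik.Refl W → E) (ha : Cherednik.IsRootChoice W a)
    (c : Cherednik.Refl W → ℂ) (hc : Cherednik.IsInvariant W c) :
    -- the generalized Duflo theorem
    (∀ I : Ideal (Cherednik.H W a c), I.IsTwoSided → I ≠ ⊤ →
      List.TFAE [
        IsPrimitiveIdeal I,
        IsPrimeTwoSidedIdeal I,
        ∃ (M : Type u) (_ : AddCommGroup M) (_ : Module (Cherednik.H W a c) M),
          Cherednik.InOUp W a c M ∧ IsSimpleModule (Cherednik.H W a c) M ∧
            I = Module.annihilator (Cherednik.H W a c) M,
        ∃ (M : Type u) (_ : AddCommGroup M) (_ : Module (Cherednik.H W a c)ᵐᵒᵖ M),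
          Cherednik.InODown W a c M ∧ IsSimpleModule (Cherednik.H W a c)ᵐᵒᵖ M ∧
            ∀ r : Cherednik.H W a c, r ∈ I ↔ ∀ m : M, MulOpposite.op r • m = 0]) ∧
    -- every primitive ideal is the annihilator of a simple highest weight module
    (∀ I : Ideal (Cherednik.H W a c), IsPrimitiveIdeal I →
      ∃ (V : Type u) (_ : AddCommGroup V) (_ : Module ℂ V) (σ : Representation ℂ W V),
        σ.IsIrreducible ∧ IsSimpleModule (Cherednik.H W a c) (Cherednik.L a c σ) ∧
          I = Module.annihilator (Cherednik.H W a c) (Cherednik.L a c σ)) ∧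
    -- there are finitely many primitive ideals
    {I : Ideal (Cherednik.H W a c) | IsPrimitiveIdeal I}.Finite ∧
    -- finite length as a bimodule
    HasFiniteLengthAsBimodule (Cherednik.H W a c) := by
  have : Finite W := hW.1
  exact mainTheorem9_general W a ha c hc
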